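/- Let $0<\alpha<1$, $p>1$ be real, $\max\{\alpha,\tfrac12\}<\beta<1$, and $\mathbb T=\mathbb R/2\pi\mathbb Z$. Let $\mathcal X^\beta$ be the space of real, even, zero-mean, $\beta$-Hölder continuous functions on $\mathbb T$ with the norm $\|\varphi\|_\infty+\sup_{x\ne y}|\varphi(x)-\varphi(y)|/|x-y|^\beta$, and let $\mathbb R_+=[0,\infty)$. For $\varphi\in\mathcal X^\beta$ let $|\mathrm D|^{-\alpha}\varphi(x)=\sum_{j\in\mathbb Z\setminus\{0\}}|j|^{-\alpha}\hat\varphi(j)e^{ijx}$, where $\hat\varphi(j)=\frac1{2\pi}\int_{\mathbb T}\varphi(y)e^{-ijy}\,dy$. For $\varepsilon>0$ let $n^\varepsilon$ be one of the functions $$n^\varepsilon(x)=(x^2+\varepsilon^2)^{p/2}-\varepsilon^p,\qquad n^\varepsilon(x)=x\bigl((x^2+\varepsilon^2)^{(p-1)/2}-\varepsilon^{p-1}\bigr),$$ and for $(\varphi,c)\in\mathcal X^\beta\times\mathbb R_+$ put $$F^\varepsilon(\varphi,c)=|\mathrm D|^{-\alpha}\varphi-\bigl(c\varphi-n^\varepsilon(\varphi)\bigr)-\frac1{2\pi}\int_{\mathbb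 T}n^\varepsilon(\varphi(y))\,dy .$$ Theorem (Local bifurcation). For every $\varepsilon>0$, every integer $k\ge1$ and either choice of $n^\varepsilon$ there are $\delta>0$ and an injective real-analytic curve $$s\mapsto(\varphi_k^\varepsilon(s),c_k^\varepsilon(s))\in\mathcal X^\beta\times\mathbb R_+,\qquad -\delta<s<\delta,$$ with nowhere vanishing derivative, such that $(\varphi_k^\varepsilon(0),c_k^\varepsilon(0))=(0,k^{-\alpha})$ and, for all $|s|<\delta$, $\varphi_k^\varepsilon(s)$ is $2\pi/k$-periodic, $F^\varepsilon(\varphi_k^\varepsilon(s),c_k^\varepsilon(s))=0$, and $\varphi_k^\varepsilon(s)\neq0$ if $s\neq0$. Moreover there is a neighbourhood $U$ of $(0,k^{-\alpha})$ in $\mathcal X^\beta\times\mathbb R_+$ such that $$\{(\varphi,c)\in U: F^\varepsilon(\varphi,c)=0,\ \varphi\ne0\}=\{(\varphi_k^\varepsilon(s),c_k^\varepsilon(s)): 0<|s|<\delta\}.$$ -/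

import Mathlib

open Set Filter Topology MeasureTheory
open scoped NNReal

/-- The torus `ℝ / 2πℤ`, with its quotient metric and quotient group structure. -/
abbrev Torus : Type := AddCircle (2 * Real.pi)

instance instFactTwoPiPos : Fact (0 < 2 * Real.pi) := ⟨Real.two_pi_pos⟩

/-- The mean `(1 / 2π) ∫ f` over the torus (`haarAddCircle` has total mass one). -/
noncomputable def torusMean (f : Torus → ℝ) : ℝ :=
  ∫ x, f x ∂(AddCircle.haarAddCircle : Measure Torus)

/-- The `β`-Hölder continuous real functions on the torus that are even and have zero mean,
as a subspace of the continuous functions. -/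
noncomputable def evenHolderSubmodule (β : ℝ≥0) : Submodule ℝ C(Torus, ℝ) where
  carrier := {φ | MemHolder β φ ∧ torusMean φ = 0 ∧ ∀ x, φ (-x) = φ x}
  zero_mem' := ⟨memHolder_zero, by simp [torusMean], by simp⟩
  add_mem' := by
    rintro φ ψ ⟨h1, h2, h3⟩ ⟨k1, k2, k3⟩
    refine ⟨h1.add k1, ?_, fun x => by simp [h3, k3]⟩
    have hφ : Integrable φ (AddCircle.haarAddCircle : Measure Torus) :=
      φ.continuous.integrable_of_hasCompactSupport (HasCompactSupport.of_compactSpace _)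
    have hψ : Integrable ψ (AddCircle.haarAddCircle : Measure Torus) :=
      ψ.continuous.integrable_of_hasCompactSupport (HasCompactSupport.of_compactSpace _)
    have := integral_add hφ hψ
    simp only [torusMean] at h2 k2 ⊢
    simpa [h2, k2] using this
  smul_mem' := by
    rintro c φ ⟨h1, h2, h3⟩
    refine ⟨h1.smul, ?_, fun x => by simp [h3]⟩
    simp only [torusMean] at h2 ⊢
    simp [integral_const_mul, h2]

/-- The space of even `β`-Hölder continuous functions of zero mean on the torus. A type of its
own, so that it carries the Hölder norm and not the norm induced by the continuous functions. -/
def EvenHolder (β : ℝ≥0) : Type := evenHolderSubmodule β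

namespace EvenHolder

variable {β : ℝ≥0}

noncomputable instance : AddCommGroup (EvenHolder β) :=
  inferInstanceAs (AddCommGroup (evenHolderSubmodule β))

noncomputable instance : Module ℝ (EvenHolder β) :=
  inferInstanceAs (Module ℝ (evenHolderSubmodule β))

/-- The underlying continuous function. -/
noncomputable def toCont (φ : EvenHolder β) : C(Torus, ℝ) := Subtype.val φ

noncomputable instance : CoeFun (EvenHolder β) (fun _ => Torus → ℝ) := ⟨fun φ => φ.toCont⟩

theorem toCont_add (φ ψ : EvenHolder β) : (φ + ψ).toCont = φ.toCont + ψ.toCont := rfl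

theorem toCont_smul (a : ℝ) (φ : EvenHolder β) : (a • φ).toCont = a • φ.toCont := rfl

theorem toCont_zero : (0 : EvenHolder β).toCont = 0 := rfl

theorem memHolder (φ : EvenHolder β) : MemHolder β φ := (Subtype.property φ).1

/-- The Hölder norm: the supremum norm plus the `β`-Hölder seminorm. -/
noncomputable instance : Norm (EvenHolder β) :=
  ⟨fun φ => ‖φ.toCont‖ + (nnHolderNorm β φ : ℝ)⟩

theorem norm_def (φ : EvenHolder β) : ‖φ‖ = ‖φ.toCont‖ + (nnHolderNorm β φ : ℝ) := rfl

theorem normCore : NormedSpace.Core ℝ (EvenHolder β) where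
  norm_nonneg φ := by rw [norm_def]; positivity
  norm_smul a φ := by
    have h := φ.memHolder.nnHolderNorm_smul a
    rw [norm_def, norm_def, toCont_smul, norm_smul, ContinuousMap.coe_smul, h]
    push_cast
    ring
  norm_triangle φ ψ := by
    have h : (nnHolderNorm β (⇑φ.toCont + ⇑ψ.toCont) : ℝ) ≤
        nnHolderNorm β φ + nnHolderNorm β ψ := by
      exact_mod_cast φ.memHolder.nnHolderNorm_add_le ψ.memHolder
    have h' := norm_add_le φ.toCont ψ.toCont
    rw [norm_def, norm_def, norm_def, toCont_add, ContinuousMap.coe_add]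
    linarith
  norm_eq_zero_iff φ := by
    constructor
    · intro h
      rw [norm_def] at h
      have h0 : ‖φ.toCont‖ = 0 := le_antisymm
        (by have := (nnHolderNorm β φ).coe_nonneg; linarith) (norm_nonneg _)
      exact Subtype.ext (norm_eq_zero.1 h0)
    · rintro rfl
      rw [norm_def, toCont_zero, ContinuousMap.coe_zero, nnHolderNorm_zero]
      simp

noncomputable instance : NormedAddCommGroup (EvenHolder β) := NormedAddCommGroup.ofCore normCore

noncomputable instance : NormedSpace ℝ (EvenHolder β) := NormedSpace.ofCore normCore

end EvenHolder

/-- The two types of nonlinearity: `n(x) = |x|^p` (`abs`) and `n(x) = x |x|^(p-1)` (`sgn`). -/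
inductive NonlinearityType
  | abs
  | sgn

/-- The analytic regularisation `n^ε` of the nonlinearity `n`. -/
noncomputable def regNonlinearity : NonlinearityType → (p ε : ℝ) → ℝ → ℝ
  | .abs, p, ε, x => (x ^ 2 + ε ^ 2) ^ (p / 2) - ε ^ p
  | .sgn, p, ε, x => x * ((x ^ 2 + ε ^ 2) ^ ((p - 1) / 2) - ε ^ (p - 1))

/-- The Fourier multiplier `|D|^(-α)` acting on a function of zero mean: the function with Fourier
series `∑_{k ≠ 0} |k|^(-α) φ̂(k) e^{ikx}`. The series converges absolutely for `β`-Hölder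
continuous functions with `β > 1/2`. -/
noncomputable def dispersion (α : ℝ) (φ : Torus → ℝ) (x : Torus) : ℂ :=
  ∑' k : ℤ, if k = 0 then 0 else
    ((|(k : ℝ)| ^ (-α) : ℝ) : ℂ) * fourierCoeff (fun y : Torus => (φ y : ℂ)) k * fourier k x

/-- The regularised steady operator
`F^ε(φ, c) = |D|^(-α) φ - (c φ - n^ε(φ)) - (1 / 2π) ∫ n^ε(φ)`. -/
noncomputable def steadyReg (n : NonlinearityType) (α p ε : ℝ) (φ : Torus → ℝ) (c : ℝ)
    (x : Torus) : ℂ :=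
  dispersion α φ x - ((c * φ x - regNonlinearity n p ε (φ x) : ℝ) : ℂ)
    - ((torusMean (fun y => regNonlinearity n p ε (φ y)) : ℝ) : ℂ)

/-- `(φ, c)` is a solution, with nonnegative speed, of the equation `F^ε(φ, c) = 0`. -/
def IsSteadySolution (n : NonlinearityType) (α p ε : ℝ) {β : ℝ≥0}
    (q : EvenHolder β × ℝ) : Prop :=
  0 ≤ q.2 ∧ ∀ x, steadyReg n α p ε q.1 q.2 x = 0

/-! Write the regularised nonlinearity as `x * m x` with `m` analytic at 0 and `m 0 = 0`. Let `K` be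
the multiplier `|D|^(-α)` and let `B φ ψ` be `m(φ) ψ` minus its mean. Near `(0, k^(-α))` the steady
equation becomes `K φ - c φ + B φ φ = 0` in the Hölder space, and `k^(-α)` is a simple eigenvalue of
`K` with eigenvector `v = cos (k x)` and dual functional `ℓ`, twice the `k`-th cosine coefficient.

`exists_analytic_branch` solves this abstractly. Substituting `φ = s (v + w)` with `ℓ w = 0` and
dividing by `s` leaves an equation for `w` and `c - c₀`, packed into one unknown `u`, to which the
analytic implicit function theorem applies. To catch every small solution, the Lyapunov-Schmidt
estimate `eventually_norm_sub_smul_le` bounds the transversal part by a small multiple of `|ℓ φ|`,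
so the division by `s` keeps the solution inside the region of uniqueness.

Analyticity of `B` holds because the Hölder functions form a Banach algebra, in which the power
series of `m` can be summed. Invertibility of `K - c₀ - ℓ ⊗ v` is the Fredholm alternative for
compact `K`. Compactness (`exists_isCompactOperator_multiplier`) comes from convexity of `n^(-α)`:
`K` is a norm-convergent combination of Fejér operators weighted by second differences. Each has
finite rank and, its kernel being nonnegative, norm at most the mean of the kernel; no smoothing
estimate is needed. Bernstein's theorem `summable_cosCoeff`, where `β > 1/2` enters, identifies `K
φ` with the pointwise Fourier series.

Periodicity follows from uniqueness: the branch of `k^(-α) K` at the first mode, dilated by `x ↦ k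
x`, solves the original equation with the same amplitude, hence is the branch. -/

/-! ### Analytic bifurcation from a simple eigenvalue -/

section SimpleEigenvalue

variable {E : Type*} [NormedAddCommGroup E] [NormedSpace ℝ E]

/-- The equation of bifurcation from a simple eigenvalue after blow-up: with
`w = u - ℓ u • v`, the amplitude `s` has been divided out of the equation at the point
`(s • (v + w), c₀ + ℓ u)`. -/
noncomputable def blownUpEquation (K : E →L[ℝ] E) (v : E) (ℓ : E →L[ℝ] ℝ) (c₀ : ℝ)
    (B : E → E →L[ℝ] E) (q : ℝ × E) : E :=
  K q.2 - c₀ • q.2 - ℓ q.2 • (v + (q.2 - ℓ q.2 • v))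
    + B (q.1 • (v + (q.2 - ℓ q.2 • v))) (v + (q.2 - ℓ q.2 • v))

/-- Since `(K - c₀) v = 0`, replacing `w = u - ℓ u • v` by `u` in `K w - c₀ w` changes nothing; the
speed correction `c - c₀` is stored as `ℓ u`. -/
theorem smul_blownUpEquation {K : E →L[ℝ] E} {v : E} {c₀ : ℝ} (ℓ : E →L[ℝ] ℝ)
    (B : E → E →L[ℝ] E) (hKv : K v = c₀ • v) (s : ℝ) (u : E) :
    s • blownUpEquation K v ℓ c₀ B (s, u) =
      K (s • (v + (u - ℓ u • v))) - (c₀ + ℓ u) • (s • (v + (u - ℓ u • v)))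
        + B (s • (v + (u - ℓ u • v))) (s • (v + (u - ℓ u • v))) := by
  simp only [blownUpEquation, map_smul, map_add, map_sub, hKv]
  module

theorem analyticAt_blownUpEquation (K : E →L[ℝ] E) (v : E) (ℓ : E →L[ℝ] ℝ) (c₀ : ℝ)
    {B : E → E →L[ℝ] E} (hB : AnalyticAt ℝ B 0) :
    AnalyticAt ℝ (blownUpEquation K v ℓ c₀ B) 0 := by
  have h1 : AnalyticAt ℝ (fun q : ℝ × E => q.1) 0 := analyticAt_fst
  have h2 : AnalyticAt ℝ (fun q : ℝ × E => q.2) 0 := analyticAt_snd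
  have hℓ : AnalyticAt ℝ (fun q : ℝ × E => ℓ q.2) 0 := (ℓ.analyticAt _).comp h2
  have hK : AnalyticAt ℝ (fun q : ℝ × E => K q.2) 0 := (K.analyticAt _).comp h2
  have hw : AnalyticAt ℝ (fun q : ℝ × E => v + (q.2 - ℓ q.2 • v)) 0 :=
    analyticAt_const.add (h2.sub (hℓ.smul analyticAt_const))
  have hBw : AnalyticAt ℝ (fun q : ℝ × E => B (q.1 • (v + (q.2 - ℓ q.2 • v)))) 0 :=
    AnalyticAt.comp_of_eq (g := B) (f := fun q : ℝ × E => q.1 • (v + (q.2 - ℓ q.2 • v))) hB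
      (h1.smul hw) (by simp)
  exact ((hK.sub (analyticAt_const.smul h2)).sub (hℓ.smul hw)).add
    ((ContinuousLinearMap.analyticAt_bilinear (.id ℝ (E →L[ℝ] E)) (B 0, v)).comp_of_eq
      (hBw.prod hw) (by simp))

/-- At `s = 0` the nonlinear term is `B 0 = 0` applied to a vector, and the only other nonlinear
term, `ℓ u • (u - ℓ u • v)`, is quadratic in `u`. -/
theorem fderiv_blownUpEquation_comp_inr (K : E →L[ℝ] E) (v : E) (ℓ : E →L[ℝ] ℝ) (c₀ : ℝ)
    {B : E → E →L[ℝ] E} (hB : AnalyticAt ℝ B 0) (hB0 : B 0 = 0) [CompleteSpace E] :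
    fderiv ℝ (blownUpEquation K v ℓ c₀ B) 0 ∘L .inr ℝ ℝ E =
      K - c₀ • ContinuousLinearMap.id ℝ E - ℓ.smulRight v := by
  have hG := (analyticAt_blownUpEquation K v ℓ c₀ hB).differentiableAt.hasFDerivAt
  have h1 : HasFDerivAt (fun u : E => blownUpEquation K v ℓ c₀ B (0, u))
      (fderiv ℝ (blownUpEquation K v ℓ c₀ B) 0 ∘L .inr ℝ ℝ E) 0 :=
    HasFDerivAt.comp (f := fun u : E => ((0 : ℝ), u)) (0 : E) hG
      (ContinuousLinearMap.inr ℝ ℝ E).hasFDerivAt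
  have h2 : HasFDerivAt (fun u : E => K u - c₀ • u - ℓ u • (v + (u - ℓ u • v)))
      (K - c₀ • ContinuousLinearMap.id ℝ E - ℓ.smulRight v) 0 := by
    have hℓ : HasFDerivAt (fun u : E => ℓ u) ℓ 0 := ℓ.hasFDerivAt
    have hw : HasFDerivAt (fun u : E => v + (u - ℓ u • v))
        (ContinuousLinearMap.id ℝ E - ℓ.smulRight v) 0 :=
      ((hasFDerivAt_id _).sub (hℓ.smul_const v)).const_add v
    refine ((K.hasFDerivAt.sub ((hasFDerivAt_id _).const_smul c₀)).sub (hℓ.smul hw)).congr_fderiv ?_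
    ext u
    simp
  have h3 : (fun u : E => blownUpEquation K v ℓ c₀ B (0, u)) =
      fun u : E => K u - c₀ • u - ℓ u • (v + (u - ℓ u • v)) := by
    ext u
    simp [blownUpEquation, hB0]
  rw [h3] at h1
  exact h1.unique h2

/-- **Lyapunov-Schmidt estimate**: near `(0, c₀)`, the component of a solution transversal to the
kernel is small compared with the component along the kernel. -/
theorem eventually_norm_sub_smul_le {K : E →L[ℝ] E} {v : E} {ℓ : E →L[ℝ] ℝ} {c₀ : ℝ}
    (hℓv : ℓ v = 1) (hKv : K v = c₀ • v) (hℓK : ∀ x, ℓ (K x) = c₀ * ℓ x)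
    (hL : (K - c₀ • ContinuousLinearMap.id ℝ E - ℓ.smulRight v).IsInvertible)
    {B : E → E →L[ℝ] E} (hB : ContinuousAt B 0) (hB0 : B 0 = 0) {η : ℝ} (hη : 0 < η) :
    ∀ᶠ q in 𝓝 ((0 : E), c₀), K q.1 - q.2 • q.1 + B q.1 q.1 = 0 →
      ‖q.1 - ℓ q.1 • v‖ ≤ η * |ℓ q.1| := by
  obtain ⟨L, hL⟩ := hL
  set Q : E →L[ℝ] E := ContinuousLinearMap.id ℝ E - ℓ.smulRight v with hQ
  set S : ℝ := ‖(L.symm : E →L[ℝ] E)‖ with hS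
  have hS0 : 0 ≤ S := norm_nonneg _
  -- the smallness required of `c - c₀` and of `B φ`
  obtain ⟨τ, hτ0, hτ⟩ : ∃ τ > 0, S * τ * (1 + ‖Q‖) ≤ 1 / 2 ∧
      2 * (S * τ * ‖Q‖ * ‖v‖) ≤ η := by
    refine ⟨min (1 / (2 * (S * (1 + ‖Q‖) + 1))) (η / (2 * (S * ‖Q‖ * ‖v‖) + 1)), by positivity,
      ?_, ?_⟩
    · calc S * min (1 / (2 * (S * (1 + ‖Q‖) + 1))) (η / (2 * (S * ‖Q‖ * ‖v‖) + 1)) * (1 + ‖Q‖)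
          ≤ S * (1 / (2 * (S * (1 + ‖Q‖) + 1))) * (1 + ‖Q‖) := by gcongr; exact min_le_left _ _
        _ ≤ 1 / 2 := by
          rw [mul_one_div, div_mul_eq_mul_div, div_le_div_iff₀ (by positivity) (by norm_num)]
          nlinarith [norm_nonneg Q]
    · calc 2 * (S * min (1 / (2 * (S * (1 + ‖Q‖) + 1))) (η / (2 * (S * ‖Q‖ * ‖v‖) + 1))
            * ‖Q‖ * ‖v‖) ≤ 2 * (S * (η / (2 * (S * ‖Q‖ * ‖v‖) + 1)) * ‖Q‖ * ‖v‖) := by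
            gcongr; exact min_le_right _ _
        _ = η * (2 * (S * ‖Q‖ * ‖v‖) / (2 * (S * ‖Q‖ * ‖v‖) + 1)) := by ring
        _ ≤ η * 1 := by
          gcongr
          rw [div_le_one (by positivity)]
          linarith
        _ = η := mul_one η
  have e1 : ∀ᶠ q in 𝓝 ((0 : E), c₀), ‖B q.1‖ < τ := by
    have : Tendsto (fun q : E × ℝ => ‖B q.1‖) (𝓝 ((0 : E), c₀)) (𝓝 ‖B 0‖) :=
      (hB.tendsto.comp (continuous_fst.tendsto' _ _ rfl)).norm
    rw [hB0, norm_zero] at this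
    exact this.eventually (gt_mem_nhds hτ0)
  have e2 : ∀ᶠ q in 𝓝 ((0 : E), c₀), |q.2 - c₀| < τ := by
    have : Tendsto (fun q : E × ℝ => |q.2 - c₀|) (𝓝 ((0 : E), c₀)) (𝓝 |c₀ - c₀|) :=
      (continuousAt_snd.tendsto.sub_const c₀).abs
    rw [sub_self, abs_zero] at this
    exact this.eventually (gt_mem_nhds hτ0)
  filter_upwards [e1, e2] with q hq1 hq2 hq
  obtain ⟨φ, c⟩ := q
  dsimp only at *
  set z := φ - ℓ φ • v with hz
  have hφ : φ = ℓ φ • v + z := by rw [hz]; abel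
  -- This is the equation projected by `Q`, which commutes with `K`; as `ℓ z = 0`, the operator `L`
  -- acts on `z` as `K - c₀`.
  have hLz : L z = (c - c₀) • z - Q (B φ φ) := by
    have h1 : L z = K z - c₀ • z - ℓ z • v := by
      have := congrArg (fun T : E →L[ℝ] E => T z) hL
      simpa using this
    have h2 : ℓ z = 0 := by simp [hz, hℓv]
    have h3 : B φ φ = c • φ - K φ := by
      rw [← sub_eq_zero, ← hq]; abel
    rw [h1, h2, h3]
    simp only [hQ, hz, map_sub, map_smul, hKv, sub_apply,
      ContinuousLinearMap.id_apply, ContinuousLinearMap.smulRight_apply, hℓK]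
    module
  have hzS : ‖z‖ ≤ S * (τ * ‖z‖ + ‖Q‖ * (τ * (|ℓ φ| * ‖v‖ + ‖z‖))) := by
    have h1 : z = (L.symm : E →L[ℝ] E) ((c - c₀) • z - Q (B φ φ)) := by
      rw [← hLz]; simp
    calc ‖z‖ ≤ S * ‖(c - c₀) • z - Q (B φ φ)‖ := by
          conv_lhs => rw [h1]
          exact ContinuousLinearMap.le_opNorm _ _
      _ ≤ S * (‖(c - c₀) • z‖ + ‖Q (B φ φ)‖) := by gcongr; exact norm_sub_le _ _
      _ ≤ S * (τ * ‖z‖ + ‖Q‖ * (τ * (|ℓ φ| * ‖v‖ + ‖z‖))) := by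
          gcongr
          · rw [norm_smul, Real.norm_eq_abs]; gcongr
          · refine (Q.le_opNorm _).trans ?_
            gcongr
            refine ((B φ).le_opNorm _).trans ?_
            gcongr
            calc ‖φ‖ = ‖ℓ φ • v + z‖ := by rw [← hφ]
              _ ≤ ‖ℓ φ • v‖ + ‖z‖ := norm_add_le _ _
              _ = |ℓ φ| * ‖v‖ + ‖z‖ := by rw [norm_smul, Real.norm_eq_abs]
  have h5 : S * (τ * ‖z‖ + ‖Q‖ * (τ * (|ℓ φ| * ‖v‖ + ‖z‖)))
      = (S * τ * (1 + ‖Q‖)) * ‖z‖ + (S * τ * ‖Q‖ * ‖v‖) * |ℓ φ| := by ring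
  -- The choice of `τ` lets half of `‖z‖` be absorbed on the left.
  have h6 : (S * τ * (1 + ‖Q‖)) * ‖z‖ ≤ 1 / 2 * ‖z‖ := by gcongr; exact hτ.1
  have h7 : 2 * (S * τ * ‖Q‖ * ‖v‖) * |ℓ φ| ≤ η * |ℓ φ| := by gcongr; exact hτ.2
  linarith

/-- **Analytic bifurcation from a simple eigenvalue.** If `c₀` is an algebraically simple
eigenvalue of `K` with eigenvector `v` and dual eigenvector `ℓ`, then the solutions of
`K φ - c φ + B(φ) φ = 0` near `(0, c₀)` with `φ ≠ 0` form an analytic curve parametrised by `ℓ φ`. -/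
theorem exists_analytic_branch [CompleteSpace E] {K : E →L[ℝ] E} {v : E} {ℓ : E →L[ℝ] ℝ} {c₀ : ℝ}
    (hℓv : ℓ v = 1) (hKv : K v = c₀ • v) (hℓK : ∀ x, ℓ (K x) = c₀ * ℓ x)
    (hL : (K - c₀ • ContinuousLinearMap.id ℝ E - ℓ.smulRight v).IsInvertible)
    {B : E → E →L[ℝ] E} (hB : AnalyticAt ℝ B 0) (hB0 : B 0 = 0) :
    ∃ γ : ℝ → E × ℝ, AnalyticAt ℝ γ 0 ∧ γ 0 = (0, c₀) ∧ (∀ s, ℓ (γ s).1 = s) ∧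
      (∀ᶠ s in 𝓝 0, K (γ s).1 - (γ s).2 • (γ s).1 + B (γ s).1 (γ s).1 = 0) ∧
      ∀ᶠ q in 𝓝 ((0 : E), c₀), K q.1 - q.2 • q.1 + B q.1 q.1 = 0 → q.1 ≠ 0 → q = γ (ℓ q.1) := by
  set G := blownUpEquation K v ℓ c₀ B with hG
  have hGa : ContDiffAt ℝ ⊤ G ((0 : ℝ), (0 : E)) :=
    (analyticAt_blownUpEquation K v ℓ c₀ hB).contDiffAt
  have hG0 : G ((0 : ℝ), (0 : E)) = 0 := by simp [hG, blownUpEquation, hB0]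
  have hinv : (fderiv ℝ G ((0 : ℝ), (0 : E)) ∘L .inr ℝ ℝ E).IsInvertible := by
    have := fderiv_blownUpEquation_comp_inr K v ℓ c₀ hB hB0
    rw [← hG] at this
    change (fderiv ℝ G 0 ∘L .inr ℝ ℝ E).IsInvertible
    rw [this]
    exact hL
  have htop : (⊤ : WithTop ℕ∞) ≠ 0 := by simp
  set u := hGa.implicitFunction htop hinv with hu
  have hu0 : u 0 = 0 := hGa.implicitFunction_apply_self htop hinv
  have huan : AnalyticAt ℝ u 0 := by
    have := hGa.contDiffAt_implicitFunction htop hinv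
    exact ContDiffAt.analyticAt this
  have husol : ∀ᶠ s in 𝓝 (0 : ℝ), G (s, u s) = 0 := by
    have := hGa.eventually_apply_implicitFunction htop hinv
    rwa [hG0] at this
  have huniq : ∀ᶠ q in 𝓝 ((0 : ℝ), (0 : E)), G q = 0 → u q.1 = q.2 := by
    have := hGa.eventually_apply_eq_iff_implicitFunction htop hinv
    rw [hG0] at this
    exact this.mono fun q hq => hq.1
  refine ⟨fun s => (s • (v + (u s - ℓ (u s) • v)), c₀ + ℓ (u s)), ?_, ?_, ?_, ?_, ?_⟩
  · have hℓu : AnalyticAt ℝ (fun s => ℓ (u s)) 0 := (ℓ.analyticAt _).comp huan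
    exact (analyticAt_id.smul
      (analyticAt_const.add (huan.sub (hℓu.smul analyticAt_const)))).prod (analyticAt_const.add hℓu)
  · simp [hu0]
  · intro s
    simp [hℓv]
  · filter_upwards [husol] with s hs
    rw [← smul_blownUpEquation ℓ B hKv, ← hG, hs, smul_zero]
  · obtain ⟨r, hr0, hr⟩ := Metric.eventually_nhds_iff.1 huniq
    -- With transversal part at most `η |s|` and `|c - c₀| < η`, the rescaled unknown has norm at
    -- most `η (1 + ‖v‖) = r / 2`.
    set η := r / (2 * (1 + ‖v‖)) with hη
    have hη0 : 0 < η := by positivity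
    have e1 : ∀ᶠ q in 𝓝 ((0 : E), c₀), |ℓ q.1| < r := by
      have : Tendsto (fun q : E × ℝ => |ℓ q.1|) (𝓝 ((0 : E), c₀)) (𝓝 |ℓ 0|) :=
        ((ℓ.continuous.comp continuous_fst).tendsto ((0 : E), c₀)).abs
      rw [map_zero, abs_zero] at this
      exact this.eventually (gt_mem_nhds hr0)
    have e2 : ∀ᶠ q in 𝓝 ((0 : E), c₀), |q.2 - c₀| < η := by
      have : Tendsto (fun q : E × ℝ => |q.2 - c₀|) (𝓝 ((0 : E), c₀)) (𝓝 |c₀ - c₀|) :=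
        (continuousAt_snd.tendsto.sub_const c₀).abs
      rw [sub_self, abs_zero] at this
      exact this.eventually (gt_mem_nhds hη0)
    filter_upwards [eventually_norm_sub_smul_le hℓv hKv hℓK hL hB.continuousAt hB0 hη0, e1, e2]
      with q hq1 hq2 hq3 hq hq0
    obtain ⟨φ, c⟩ := q
    dsimp only at *
    have hz := hq1 hq
    set s := ℓ φ with hs
    have hs0 : s ≠ 0 := by
      intro h
      rw [h] at hz
      simp only [zero_smul, sub_zero, abs_zero, mul_zero, norm_le_zero_iff] at hz
      exact hq0 hz
    -- Inverse of the blow-up: the transversal part divided by the amplitude, with the speed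
    -- correction in the direction `v`.
    set y : E := s⁻¹ • (φ - s • v) + (c - c₀) • v with hy
    have hℓy : ℓ y = c - c₀ := by simp [hy, hℓv, ← hs]
    have hyφ : s • (v + (y - ℓ y • v)) = φ := by
      rw [hℓy, hy, add_sub_cancel_right, smul_add, smul_smul, mul_inv_cancel₀ hs0, one_smul]
      abel
    have hGy : G (s, y) = 0 := by
      have h1 := smul_blownUpEquation ℓ B hKv s y
      rw [hyφ, hℓy, add_sub_cancel, hq] at h1
      exact (smul_eq_zero.1 h1).resolve_left hs0
    have hynorm : ‖y‖ < r := by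
      calc ‖y‖ ≤ ‖s⁻¹ • (φ - s • v)‖ + ‖(c - c₀) • v‖ := norm_add_le _ _
        _ = |s|⁻¹ * ‖φ - s • v‖ + |c - c₀| * ‖v‖ := by
          rw [norm_smul, norm_smul, norm_inv, Real.norm_eq_abs, Real.norm_eq_abs]
        _ ≤ |s|⁻¹ * (η * |s|) + η * ‖v‖ := by gcongr
        _ = η * (1 + ‖v‖) := by
          have : |s| ≠ 0 := abs_ne_zero.2 hs0
          field_simp
        _ = r / 2 := by
          rw [hη]
          have : 1 + ‖v‖ ≠ 0 := by positivity
          field_simp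
        _ < r := by linarith
    have hus : u s = y := by
      refine hr (y := (s, y)) ?_ hGy
      rw [Prod.dist_eq, max_lt_iff, dist_zero_right, dist_zero_right, Real.norm_eq_abs]
      exact ⟨hq2, hynorm⟩
    rw [hus, hyφ, hℓy, add_sub_cancel]

end SimpleEigenvalue

/-! ### Means and Hölder estimates on the torus -/

section TorusMean

theorem ContinuousMap.integrable_haarAddCircle (f : C(Torus, ℝ)) :
    Integrable f (AddCircle.haarAddCircle : Measure Torus) :=
  f.continuous.integrable_of_hasCompactSupport (HasCompactSupport.of_compactSpace _)

theorem torusMean_add (f g : C(Torus, ℝ)) : torusMean (f + g) = torusMean f + torusMean g :=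
  integral_add f.integrable_haarAddCircle g.integrable_haarAddCircle

theorem torusMean_sub (f g : C(Torus, ℝ)) : torusMean (f - g) = torusMean f - torusMean g :=
  integral_sub f.integrable_haarAddCircle g.integrable_haarAddCircle

theorem torusMean_smul (a : ℝ) (f : Torus → ℝ) : torusMean (a • f) = a * torusMean f :=
  integral_const_mul a f

theorem torusMean_const (a : ℝ) : torusMean (fun _ => a) = a := by
  simp [torusMean]

theorem abs_torusMean_le {f : Torus → ℝ} {C : ℝ} (h : ∀ x, |f x| ≤ C) : |torusMean f| ≤ C := by
  have := norm_integral_le_of_norm_le_const (μ := (AddCircle.haarAddCircle : Measure Torus))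
    (f := f) (C := C) (Eventually.of_forall h)
  simpa [torusMean] using this

end TorusMean

theorem holderWith_of_abs_sub_le {β : ℝ≥0} {f : Torus → ℝ} {C : ℝ≥0}
    (h : ∀ x y, |f x - f y| ≤ C * dist x y ^ (β : ℝ)) : HolderWith C β f := by
  intro x y
  have h1 := h x y
  rw [← Real.dist_eq] at h1
  rw [edist_dist, edist_dist, ENNReal.ofReal_rpow_of_nonneg dist_nonneg β.coe_nonneg,
    ← ENNReal.ofReal_coe_nnreal, ← ENNReal.ofReal_mul C.coe_nonneg]
  exact ENNReal.ofReal_le_ofReal h1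

theorem MemHolder.abs_sub_le {β : ℝ≥0} {f : Torus → ℝ} (hf : MemHolder β f) (x y : Torus) :
    |f x - f y| ≤ nnHolderNorm β f * dist x y ^ (β : ℝ) := by
  rw [← Real.dist_eq]
  exact hf.holderWith.dist_le x y

theorem nnHolderNorm_le_of_abs_sub_le {β : ℝ≥0} {f : Torus → ℝ} {C : ℝ} (hC : 0 ≤ C)
    (h : ∀ x y, |f x - f y| ≤ C * dist x y ^ (β : ℝ)) : (nnHolderNorm β f : ℝ) ≤ C := by
  have : HolderWith ⟨C, hC⟩ β f := holderWith_of_abs_sub_le h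
  exact_mod_cast this.nnholderNorm_le

theorem memHolder_of_abs_sub_le {β : ℝ≥0} {f : Torus → ℝ} {C : ℝ} (hC : 0 ≤ C)
    (h : ∀ x y, |f x - f y| ≤ C * dist x y ^ (β : ℝ)) : MemHolder β f :=
  ⟨⟨C, hC⟩, holderWith_of_abs_sub_le h⟩

theorem abs_mul_sub_mul_le {β : ℝ≥0} {f g : C(Torus, ℝ)} (hf : MemHolder β f)
    (hg : MemHolder β g) (x y : Torus) :
    |f x * g x - f y * g y| ≤
      (‖f‖ * nnHolderNorm β g + nnHolderNorm β f * ‖g‖) * dist x y ^ (β : ℝ) := by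
  have h1 : f x * g x - f y * g y = f x * (g x - g y) + (f x - f y) * g y := by ring
  have h2 : |f x| ≤ ‖f‖ := f.norm_coe_le_norm x
  have h3 : |g y| ≤ ‖g‖ := g.norm_coe_le_norm y
  calc |f x * g x - f y * g y| ≤ |f x| * |g x - g y| + |f x - f y| * |g y| := by
        rw [h1, ← abs_mul, ← abs_mul]; exact abs_add_le _ _
    _ ≤ ‖f‖ * (nnHolderNorm β g * dist x y ^ (β : ℝ))
        + (nnHolderNorm β f * dist x y ^ (β : ℝ)) * ‖g‖ := by
        gcongr
        · exact hg.abs_sub_le x y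
        · exact hf.abs_sub_le x y
    _ = _ := by ring

/-! ### The Banach algebra of even Hölder functions and analytic superposition -/

/-- The algebra of even `β`-Hölder continuous functions on the torus. -/
noncomputable def evenHolderSubalgebra (β : ℝ≥0) : Subalgebra ℝ C(Torus, ℝ) where
  carrier := {φ | MemHolder β φ ∧ ∀ x, φ (-x) = φ x}
  mul_mem' := by
    rintro φ ψ ⟨h1, h2⟩ ⟨k1, k2⟩
    exact ⟨memHolder_of_abs_sub_le (by positivity) (abs_mul_sub_mul_le h1 k1),
      fun x => by simp [h2, k2]⟩
  add_mem' := by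
    rintro φ ψ ⟨h1, h2⟩ ⟨k1, k2⟩
    exact ⟨h1.add k1, fun x => by simp [h2, k2]⟩
  algebraMap_mem' a := ⟨memHolder_const' (c := a), fun x => rfl⟩

/-- The algebra of even `β`-Hölder continuous functions on the torus, as a type of its own that
carries the Hölder norm. -/
def EvenHolderAlgebra (β : ℝ≥0) : Type := evenHolderSubalgebra β

namespace EvenHolderAlgebra

variable {β : ℝ≥0}

noncomputable instance : CommRing (EvenHolderAlgebra β) :=
  inferInstanceAs (CommRing (evenHolderSubalgebra β))

noncomputable instance : Algebra ℝ (EvenHolderAlgebra β) :=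
  inferInstanceAs (Algebra ℝ (evenHolderSubalgebra β))

/-- The underlying continuous function. -/
noncomputable def toCont (f : EvenHolderAlgebra β) : C(Torus, ℝ) := Subtype.val f

noncomputable instance : CoeFun (EvenHolderAlgebra β) (fun _ => Torus → ℝ) := ⟨fun f => f.toCont⟩

theorem toCont_add (f g : EvenHolderAlgebra β) : (f + g).toCont = f.toCont + g.toCont := rfl

theorem toCont_sub (f g : EvenHolderAlgebra β) : (f - g).toCont = f.toCont - g.toCont := rfl

theorem toCont_mul (f g : EvenHolderAlgebra β) : (f * g).toCont = f.toCont * g.toCont := rfl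

theorem toCont_smul (a : ℝ) (f : EvenHolderAlgebra β) : (a • f).toCont = a • f.toCont := rfl

theorem toCont_zero : (0 : EvenHolderAlgebra β).toCont = 0 := rfl

theorem toCont_one : (1 : EvenHolderAlgebra β).toCont = 1 := rfl

theorem toCont_injective : Function.Injective (toCont : EvenHolderAlgebra β → C(Torus, ℝ)) :=
  Subtype.val_injective

theorem memHolder (f : EvenHolderAlgebra β) : MemHolder β f := (Subtype.property f).1

theorem even (f : EvenHolderAlgebra β) (x : Torus) : f (-x) = f x := (Subtype.property f).2 x

/-- The Hölder norm: the supremum norm plus the `β`-Hölder seminorm. -/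
noncomputable instance : Norm (EvenHolderAlgebra β) :=
  ⟨fun f => ‖f.toCont‖ + (nnHolderNorm β f : ℝ)⟩

theorem norm_def (f : EvenHolderAlgebra β) : ‖f‖ = ‖f.toCont‖ + (nnHolderNorm β f : ℝ) := rfl

theorem normCore : NormedSpace.Core ℝ (EvenHolderAlgebra β) where
  norm_nonneg f := by rw [norm_def]; positivity
  norm_smul a f := by
    have h := f.memHolder.nnHolderNorm_smul a
    rw [norm_def, norm_def, toCont_smul, norm_smul, ContinuousMap.coe_smul, h]
    push_cast
    ring
  norm_triangle f g := by
    have h : (nnHolderNorm β (⇑f.toCont + ⇑g.toCont) : ℝ) ≤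
        nnHolderNorm β f + nnHolderNorm β g := by
      exact_mod_cast f.memHolder.nnHolderNorm_add_le g.memHolder
    have h' := norm_add_le f.toCont g.toCont
    rw [norm_def, norm_def, norm_def, toCont_add, ContinuousMap.coe_add]
    linarith
  norm_eq_zero_iff f := by
    constructor
    · intro h
      rw [norm_def] at h
      have h0 : ‖f.toCont‖ = 0 := le_antisymm
        (by have := (nnHolderNorm β f).coe_nonneg; linarith) (norm_nonneg _)
      exact Subtype.ext (norm_eq_zero.1 h0)
    · rintro rfl
      rw [norm_def, toCont_zero, ContinuousMap.coe_zero, nnHolderNorm_zero]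
      simp

theorem norm_mul_le' (f g : EvenHolderAlgebra β) : ‖f * g‖ ≤ ‖f‖ * ‖g‖ := by
  have h1 : (nnHolderNorm β (f * g) : ℝ) ≤
      ‖f.toCont‖ * nnHolderNorm β g + nnHolderNorm β f * ‖g.toCont‖ :=
    nnHolderNorm_le_of_abs_sub_le (by positivity) (abs_mul_sub_mul_le f.memHolder g.memHolder)
  have h2 : ‖(f * g).toCont‖ ≤ ‖f.toCont‖ * ‖g.toCont‖ := norm_mul_le _ _
  have h3 : (0 : ℝ) ≤ nnHolderNorm β f * nnHolderNorm β g := by positivity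
  rw [norm_def, norm_def, norm_def]
  linarith

noncomputable instance : NormedCommRing (EvenHolderAlgebra β) :=
  { (inferInstance : CommRing (EvenHolderAlgebra β)), NormedAddCommGroup.ofCore normCore with
    norm_mul_le := norm_mul_le' }

noncomputable instance : NormedAlgebra ℝ (EvenHolderAlgebra β) where
  norm_smul_le a f := (normCore.norm_smul a f).le

theorem norm_toCont_le (f : EvenHolderAlgebra β) : ‖f.toCont‖ ≤ ‖f‖ := by
  rw [norm_def]
  exact le_add_of_nonneg_right (NNReal.coe_nonneg _)

theorem abs_apply_le (f : EvenHolderAlgebra β) (x : Torus) : |f x| ≤ ‖f‖ :=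
  (f.toCont.norm_coe_le_norm x).trans f.norm_toCont_le

instance : NormOneClass (EvenHolderAlgebra β) where
  norm_one := by
    have h : nnHolderNorm β (1 : EvenHolderAlgebra β) = 0 := nnHolderNorm_const Torus β (1 : ℝ)
    rw [norm_def, h, toCont_one]
    simp

/-- Evaluation at a point, as a continuous linear functional. -/
noncomputable def evalCLM (x : Torus) : EvenHolderAlgebra β →L[ℝ] ℝ :=
  LinearMap.mkContinuous
    { toFun := fun f => f x
      map_add' := fun _ _ => rfl
      map_smul' := fun _ _ => rfl } 1 fun f => by
    rw [one_mul]; exact f.abs_apply_le x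

theorem evalCLM_apply (x : Torus) (f : EvenHolderAlgebra β) : evalCLM x f = f x := rfl

theorem pow_apply (f : EvenHolderAlgebra β) (n : ℕ) (x : Torus) : (f ^ n) x = f x ^ n := by
  induction n with
  | zero => rfl
  | succ n ih => rw [pow_succ, pow_succ, ← ih]; rfl

/-- A Cauchy sequence converges uniformly, and its Hölder estimates pass to the pointwise limit in
one of the two indices. -/
instance : CompleteSpace (EvenHolderAlgebra β) := by
  refine Metric.complete_of_cauchySeq_tendsto fun u hu => ?_
  have hbound : ∀ n m, ∀ x y, |(u n x - u m x) - (u n y - u m y)| ≤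
      dist (u n) (u m) * dist x y ^ (β : ℝ) := fun n m x y => by
    refine ((u n - u m).memHolder.abs_sub_le x y).trans ?_
    gcongr
    rw [dist_eq_norm, norm_def]
    exact le_add_of_nonneg_left (norm_nonneg _)
  have hsup : ∀ n m, dist (u n).toCont (u m).toCont ≤ dist (u n) (u m) := fun n m => by
    rw [dist_eq_norm, dist_eq_norm, ← toCont_sub]
    exact norm_toCont_le _
  have hc : CauchySeq fun n => (u n).toCont := by
    rw [Metric.cauchySeq_iff] at hu ⊢
    exact fun ε hε => (hu ε hε).imp fun N hN m hm n hn => (hsup m n).trans_lt (hN m hm n hn)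
  obtain ⟨f, hf⟩ := cauchySeq_tendsto_of_complete hc
  have hpt : ∀ x, Tendsto (fun n => u n x) atTop (𝓝 (f x)) := fun x =>
    ((ContinuousMap.evalCLM ℝ x).continuous.tendsto f).comp hf
  have hlim : ∀ ε > 0, ∃ N, ∀ n ≥ N, ∀ x y,
      |(u n x - f x) - (u n y - f y)| ≤ ε * dist x y ^ (β : ℝ) := fun ε hε => by
    obtain ⟨N, hN⟩ := Metric.cauchySeq_iff.1 hu ε hε
    refine ⟨N, fun n hn x y => ?_⟩
    refine le_of_tendsto (((tendsto_const_nhds.sub (hpt x)).sub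
      (tendsto_const_nhds.sub (hpt y))).abs) ?_
    filter_upwards [eventually_ge_atTop N] with m hm
    refine (hbound n m x y).trans ?_
    gcongr
    exact (hN n hn m hm).le
  have hfmem : f ∈ evenHolderSubalgebra β := by
    constructor
    · obtain ⟨N, hN⟩ := hlim 1 one_pos
      refine memHolder_of_abs_sub_le (C := 1 + nnHolderNorm β (u N)) (by positivity) fun x y => ?_
      have h1 := hN N le_rfl x y
      have h2 := (u N).memHolder.abs_sub_le x y
      have h3 : f x - f y = (u N x - u N y) - ((u N x - f x) - (u N y - f y)) := by ring
      rw [h3, add_mul]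
      refine (abs_sub _ _).trans ?_
      linarith
    · intro x
      refine tendsto_nhds_unique (hpt (-x)) ?_
      simp_rw [even]
      exact hpt x
  obtain ⟨g, rfl⟩ : ∃ g : EvenHolderAlgebra β, g.toCont = f := ⟨⟨f, hfmem⟩, rfl⟩
  refine ⟨g, Metric.tendsto_atTop.2 fun ε hε => ?_⟩
  obtain ⟨N, hN⟩ := hlim (ε / 3) (by positivity)
  obtain ⟨N', hN'⟩ := Metric.tendsto_atTop.1 hf (ε / 3) (by positivity)
  refine ⟨max N N', fun n hn => ?_⟩
  have h1 := nnHolderNorm_le_of_abs_sub_le (f := fun x => u n x - g x) (by positivity)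
    (hN n (le_of_max_le_left hn))
  have h2 := hN' n (le_of_max_le_right hn)
  rw [dist_eq_norm] at h2 ⊢
  calc _ = ‖(u n).toCont - g.toCont‖ + (nnHolderNorm β (fun x => u n x - g x) : ℝ) := rfl
    _ < ε := by linarith

/-- Superposition with a function that is real analytic at `0` is analytic at `0` as a map of
the Hölder algebra. -/
theorem exists_analyticAt_superposition {m : ℝ → ℝ} (hm : AnalyticAt ℝ m 0) :
    ∃ M : EvenHolderAlgebra β → EvenHolderAlgebra β, AnalyticAt ℝ M 0 ∧
      ∀ᶠ f in 𝓝 0, ∀ x, M f x = m (f x) := by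
  obtain ⟨p, hp⟩ := hm
  obtain ⟨r, hr0, hr⟩ := Metric.eventually_nhds_iff.1 (hasFPowerSeriesAt_iff.1 hp)
  simp only [zero_add, dist_zero_right] at hr
  -- The scalar Taylor coefficients define a power series in the Banach algebra; because `‖1‖ = 1`,
  -- its terms have norm exactly the modulus of the coefficients, so scalar convergence at `t`
  -- bounds its radius below.
  set P := FormalMultilinearSeries.ofScalars (EvenHolderAlgebra β) p.coeff with hP
  set t : ℝ≥0 := ⟨r / 2, by positivity⟩ with ht
  have ht0 : (0 : ℝ) < t := by rw [ht]; exact half_pos hr0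
  have hrad : (t : ENNReal) ≤ P.radius := by
    have hs : Summable fun n => (t : ℝ) ^ n • p.coeff n := by
      refine (hr (y := t) ?_).summable
      rw [Real.norm_of_nonneg t.coe_nonneg, ht]
      exact half_lt_self hr0
    obtain ⟨C, hC⟩ := hs.norm.tendsto_atTop_zero.bddAbove_range
    refine P.le_radius_of_bound C fun n => ?_
    rw [hP, FormalMultilinearSeries.ofScalars_norm]
    refine le_trans (le_of_eq ?_) (hC ⟨n, rfl⟩)
    simp only [norm_smul, norm_pow, Real.norm_of_nonneg t.coe_nonneg, mul_comm]
  have hrad0 : 0 < P.radius := lt_of_lt_of_le (by exact_mod_cast ht0) hrad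
  refine ⟨P.sum, (P.hasFPowerSeriesOnBall hrad0).analyticAt, ?_⟩
  filter_upwards [Metric.ball_mem_nhds (0 : EvenHolderAlgebra β) ht0] with f hf x
  rw [mem_ball_zero_iff] at hf
  have hsum : HasSum (fun n => P n fun _ => f) (P.sum f) := by
    refine P.hasSum ?_
    rw [Metric.mem_eball, edist_zero_right]
    refine lt_of_lt_of_le ?_ hrad
    rw [← ofReal_norm, ← ENNReal.ofReal_coe_nnreal]
    exact (ENNReal.ofReal_lt_ofReal_iff ht0).2 hf
  have h1 := (evalCLM x).hasSum hsum
  have h2 : HasSum (fun n => (f x) ^ n • p.coeff n) (m (f x)) := by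
    refine hr (lt_of_le_of_lt (f.abs_apply_le x) (hf.trans ?_))
    rw [ht]
    exact half_lt_self hr0
  refine h1.unique ?_
  convert! h2 using 2 with n
  rw [hP, FormalMultilinearSeries.ofScalars_apply_eq, map_smul, evalCLM_apply, pow_apply,
    smul_eq_mul, smul_eq_mul, mul_comm]

end EvenHolderAlgebra

/-! ### Factoring the nonlinearity -/

section Nonlinearity

theorem analyticAt_sq_add_sq_rpow {ε : ℝ} (hε : 0 < ε) (q : ℝ) :
    AnalyticAt ℝ (fun x : ℝ => (x ^ 2 + ε ^ 2) ^ q) 0 := by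
  have h1 : ContDiffAt ℝ ⊤ (fun x : ℝ => x ^ 2 + ε ^ 2) 0 := by fun_prop
  have h2 : ContDiffAt ℝ ⊤ (fun x : ℝ => (x ^ 2 + ε ^ 2) ^ q) 0 :=
    h1.rpow_const_of_ne (by positivity)
  exact h2.analyticAt

theorem hasDerivAt_sq_add_sq_rpow {ε : ℝ} (hε : 0 < ε) (q : ℝ) :
    HasDerivAt (fun x : ℝ => (x ^ 2 + ε ^ 2) ^ q) 0 0 := by
  have h1 : HasDerivAt (fun x : ℝ => x ^ 2 + ε ^ 2) 0 0 := by
    simpa using (hasDerivAt_pow 2 (0 : ℝ)).add_const (ε ^ 2)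
  simpa using h1.rpow_const (p := q) (Or.inl (by positivity))

/-- The regularised nonlinearity vanishes to second order at the origin, with an analytic
quotient. -/
theorem exists_regNonlinearity_eq_mul (n : NonlinearityType) (p : ℝ) {ε : ℝ} (hε : 0 < ε) :
    ∃ m : ℝ → ℝ, AnalyticAt ℝ m 0 ∧ m 0 = 0 ∧ ∀ x, regNonlinearity n p ε x = x * m x := by
  have hpow : ∀ q : ℝ, (ε ^ 2) ^ (q / 2) = ε ^ q := fun q => by
    rw [← Real.rpow_natCast, ← Real.rpow_mul hε.le]
    congr 1
    push_cast
    ring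
  cases n with
  | sgn =>
    refine ⟨fun x => (x ^ 2 + ε ^ 2) ^ ((p - 1) / 2) - ε ^ (p - 1),
      (analyticAt_sq_add_sq_rpow hε _).sub analyticAt_const, ?_, fun x => rfl⟩
    simp [hpow]
  | abs =>
    set f : ℝ → ℝ := fun x => (x ^ 2 + ε ^ 2) ^ (p / 2) with hf
    have hf0 : f 0 = ε ^ p := by simp [hf, hpow]
    -- The difference quotient with its removable singularity filled in; its value at 0 is `f' 0`,
    -- which vanishes since `f` depends on `x ^ 2`.
    refine ⟨dslope f 0, ?_, ?_, fun x => ?_⟩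
    · obtain ⟨P, hP⟩ := analyticAt_sq_add_sq_rpow hε (p / 2)
      exact hP.has_fpower_series_dslope_fslope.analyticAt
    · rw [dslope_same]
      exact (hasDerivAt_sq_add_sq_rpow hε _).deriv
    · have := sub_smul_dslope f 0 x
      rw [sub_zero, smul_eq_mul, hf0] at this
      rw [this]
      rfl

end Nonlinearity

/-! ### The zero-mean space as a complemented subspace of the algebra -/

namespace EvenHolder

variable {β : ℝ≥0}

theorem torusMean_eq_zero (φ : EvenHolder β) : torusMean φ = 0 := (Subtype.property φ).2.1

theorem even (φ : EvenHolder β) (x : Torus) : φ (-x) = φ x := (Subtype.property φ).2.2 x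

theorem toCont_injective : Function.Injective (toCont : EvenHolder β → C(Torus, ℝ)) :=
  Subtype.val_injective

theorem toCont_sub (φ ψ : EvenHolder β) : (φ - ψ).toCont = φ.toCont - ψ.toCont := rfl

theorem norm_toCont_le (φ : EvenHolder β) : ‖φ.toCont‖ ≤ ‖φ‖ := by
  rw [norm_def]
  exact le_add_of_nonneg_right (NNReal.coe_nonneg _)

theorem abs_apply_le (φ : EvenHolder β) (x : Torus) : |φ x| ≤ ‖φ‖ :=
  (φ.toCont.norm_coe_le_norm x).trans φ.norm_toCont_le

theorem abs_sub_le (φ : EvenHolder β) (x y : Torus) :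
    |φ x - φ y| ≤ nnHolderNorm β φ * dist x y ^ (β : ℝ) :=
  φ.memHolder.abs_sub_le x y

theorem norm_le {φ : EvenHolder β} {C D : ℝ} (hC : 0 ≤ C) (hD : 0 ≤ D) (h1 : ∀ x, |φ x| ≤ C)
    (h2 : ∀ x y, |φ x - φ y| ≤ D * dist x y ^ (β : ℝ)) : ‖φ‖ ≤ C + D := by
  rw [norm_def]
  exact add_le_add ((ContinuousMap.norm_le _ hC).2 h1) (nnHolderNorm_le_of_abs_sub_le hD h2)

/-- The inclusion into the algebra of even Hölder functions. -/
noncomputable def toAlgebra : EvenHolder β →ₗᵢ[ℝ] EvenHolderAlgebra β where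
  toFun φ := ⟨φ.toCont, φ.memHolder, φ.even⟩
  map_add' _ _ := rfl
  map_smul' _ _ := rfl
  norm_map' _ := rfl

theorem toAlgebra_apply (φ : EvenHolder β) (x : Torus) : toAlgebra φ x = φ x := rfl

end EvenHolder

namespace EvenHolderAlgebra

variable {β : ℝ≥0}

/-- Subtraction of the mean, a projection onto the functions of zero mean. -/
noncomputable def subMean : EvenHolderAlgebra β →L[ℝ] EvenHolder β :=
  LinearMap.mkContinuous
    { toFun := fun f => (⟨f.toCont - ContinuousMap.const Torus (torusMean f), by
          have h : (⇑(f.toCont - ContinuousMap.const Torus (torusMean f)) : Torus → ℝ) =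
            fun x => f x - torusMean f := rfl
          refine ⟨memHolder_of_abs_sub_le (C := nnHolderNorm β f) (by positivity) fun x y => ?_,
            ?_, fun x => ?_⟩
          · rw [h]
            simpa using f.memHolder.abs_sub_le x y
          · rw [ContinuousMap.coe_sub, torusMean_sub]
            exact sub_eq_zero.2 (torusMean_const _).symm
          · rw [h]
            simp only [f.even]⟩ : evenHolderSubmodule β)
      map_add' := fun f g => by
        refine Subtype.ext (ContinuousMap.ext fun x => ?_)
        change f x + g x - torusMean (f.toCont + g.toCont) =
          (f x - torusMean f) + (g x - torusMean g)
        rw [torusMean_add]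
        ring
      map_smul' := fun a f => by
        refine Subtype.ext (ContinuousMap.ext fun x => ?_)
        change a * f x - torusMean (a • ⇑f.toCont) = a * (f x - torusMean f)
        rw [torusMean_smul]
        ring } 2 fun f => by
    have h1 : |torusMean f| ≤ ‖f.toCont‖ := abs_torusMean_le f.toCont.norm_coe_le_norm
    refine (EvenHolder.norm_le (C := 2 * ‖f.toCont‖) (D := nnHolderNorm β f) (by positivity)
      (by positivity) (fun x => ?_) fun x y => ?_).trans ?_
    · change |f x - torusMean f| ≤ _
      have h2 : |f x| ≤ ‖f.toCont‖ := f.toCont.norm_coe_le_norm x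
      refine (abs_sub _ _).trans ?_
      linarith
    · change |(f x - torusMean f) - (f y - torusMean f)| ≤ _
      rw [sub_sub_sub_cancel_right]
      exact f.memHolder.abs_sub_le x y
    · rw [norm_def]
      have := (nnHolderNorm β f).coe_nonneg
      linarith

theorem subMean_apply (f : EvenHolderAlgebra β) (x : Torus) : subMean f x = f x - torusMean f := rfl

/-- Multiplication by an even Hölder function, followed by subtraction of the mean. -/
noncomputable def mulSubMean : EvenHolderAlgebra β →L[ℝ] EvenHolder β →L[ℝ] EvenHolder β :=
  (ContinuousLinearMap.compL ℝ (EvenHolder β) (EvenHolderAlgebra β) (EvenHolder β) subMean) ∘L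
    ((ContinuousLinearMap.compL ℝ (EvenHolder β) (EvenHolderAlgebra β)
      (EvenHolderAlgebra β)).flip EvenHolder.toAlgebra.toContinuousLinearMap) ∘L
    ContinuousLinearMap.mul ℝ (EvenHolderAlgebra β)

theorem mulSubMean_apply (f : EvenHolderAlgebra β) (φ : EvenHolder β) :
    mulSubMean f φ = subMean (f * EvenHolder.toAlgebra φ) := rfl

end EvenHolderAlgebra

namespace EvenHolder

variable {β : ℝ≥0}

/-- The zero-mean functions are the fixed points of a continuous projection of the complete algebra,
hence closed in it. -/
instance : CompleteSpace (EvenHolder β) := by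
  rw [completeSpace_iff_isComplete_range
    (EvenHolder.toAlgebra (β := β)).isometry.isUniformInducing]
  refine IsClosed.isComplete ?_
  have h : range (toAlgebra (β := β)) =
      {f | toAlgebra (EvenHolderAlgebra.subMean f) = f} := by
    ext f
    constructor
    · rintro ⟨φ, rfl⟩
      refine EvenHolderAlgebra.toCont_injective (ContinuousMap.ext fun x => ?_)
      rw [toAlgebra_apply, EvenHolderAlgebra.subMean_apply]
      change φ x - torusMean φ = φ x
      rw [torusMean_eq_zero, sub_zero]
    · exact fun hf => ⟨_, hf⟩
  rw [h]
  exact isClosed_eq (toAlgebra.continuous.comp EvenHolderAlgebra.subMean.continuous) continuous_id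

/-- The nonlinear term of the steady equation as an analytic quasilinear expression. -/
theorem exists_analyticAt_regNonlinearity (β : ℝ≥0) (n : NonlinearityType) (p : ℝ) {ε : ℝ}
    (hε : 0 < ε) :
    ∃ B : EvenHolder β → EvenHolder β →L[ℝ] EvenHolder β, AnalyticAt ℝ B 0 ∧ B 0 = 0 ∧
      ∀ᶠ φ in 𝓝 (0 : EvenHolder β), ∀ x, B φ φ x =
        regNonlinearity n p ε (φ x) - torusMean fun y => regNonlinearity n p ε (φ y) := by
  obtain ⟨m, hm, hm0, hnm⟩ := exists_regNonlinearity_eq_mul n p hε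
  obtain ⟨M, hM, hMm⟩ := EvenHolderAlgebra.exists_analyticAt_superposition (β := β) hm
  refine ⟨fun φ => EvenHolderAlgebra.mulSubMean (M (toAlgebra φ)), ?_, ?_, ?_⟩
  · refine (EvenHolderAlgebra.mulSubMean.analyticAt _).comp ?_
    exact hM.comp_of_eq (toAlgebra.toContinuousLinearMap.analyticAt _) (map_zero _)
  · have : M 0 = 0 := by
      refine EvenHolderAlgebra.toCont_injective (ContinuousMap.ext fun x => ?_)
      rw [hMm.self_of_nhds x]
      exact hm0
    simp only [map_zero, this]
  · have h : Tendsto (toAlgebra (β := β)) (𝓝 0) (𝓝 0) := by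
      simpa using (toAlgebra (β := β)).continuous.tendsto 0
    filter_upwards [h.eventually hMm] with φ hφ x
    have key : ∀ y, (M (toAlgebra φ) * toAlgebra φ) y = regNonlinearity n p ε (φ y) := by
      intro y
      rw [EvenHolderAlgebra.toCont_mul, ContinuousMap.mul_apply, hφ, hnm, mul_comm]
      rfl
    rw [EvenHolderAlgebra.mulSubMean_apply, EvenHolderAlgebra.subMean_apply, key]
    congr 2
    exact funext key

end EvenHolder

/-! ### Trigonometric modes and Fourier coefficients of even functions -/

section TorusFourier

theorem torusMean_eq_zero_of_odd {f : Torus → ℝ} (h : ∀ x, f (-x) = -f x) : torusMean f = 0 := by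
  have h1 : torusMean (fun x => f (-x)) = torusMean f :=
    integral_neg_eq_self f (AddCircle.haarAddCircle : Measure Torus)
  have h2 : torusMean (fun x => f (-x)) = -torusMean f := by
    simp only [h]
    exact integral_neg f
  linarith

theorem fourier_neg_apply (j : ℤ) (x : Torus) :
    fourier j (-x) = (starRingEnd ℂ) (fourier j x) := by
  rw [← fourier_neg, fourier_apply, fourier_apply, smul_neg, neg_smul]

theorem fourier_apply_add (j : ℤ) (x y : Torus) :
    fourier j (x + y) = fourier j x * fourier j y := by
  simp only [fourier_apply, smul_add, AddCircle.toCircle_add, Circle.coe_mul]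

theorem norm_fourier_apply (j : ℤ) (x : Torus) : ‖fourier j x‖ = 1 := by
  rw [fourier_apply, Circle.norm_coe]

/-- The function `cos (j x)` on the torus. -/
noncomputable def torusCos (j : ℤ) : C(Torus, ℝ) :=
  ⟨fun x => (fourier j x).re, Complex.continuous_re.comp (map_continuous _)⟩

/-- The function `sin (j x)` on the torus. -/
noncomputable def torusSin (j : ℤ) : C(Torus, ℝ) :=
  ⟨fun x => (fourier j x).im, Complex.continuous_im.comp (map_continuous _)⟩

theorem torusCos_apply (j : ℤ) (x : Torus) : torusCos j x = (fourier j x).re := rfl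

theorem torusSin_apply (j : ℤ) (x : Torus) : torusSin j x = (fourier j x).im := rfl

theorem torusCos_neg_apply (j : ℤ) (x : Torus) : torusCos j (-x) = torusCos j x := by
  rw [torusCos_apply, torusCos_apply, fourier_neg_apply, Complex.conj_re]

theorem torusSin_neg_apply (j : ℤ) (x : Torus) : torusSin j (-x) = -torusSin j x := by
  rw [torusSin_apply, torusSin_apply, fourier_neg_apply, Complex.conj_im]

theorem torusCos_neg (j : ℤ) : torusCos (-j) = torusCos j := by
  ext x
  rw [torusCos_apply, torusCos_apply, fourier_neg, Complex.conj_re]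

theorem torusCos_zero : torusCos 0 = 1 := by
  ext x
  rw [torusCos_apply, fourier_zero]
  rfl

theorem torusCos_sub_apply (j : ℤ) (x y : Torus) :
    torusCos j (x - y) = torusCos j x * torusCos j y + torusSin j x * torusSin j y := by
  simp only [torusCos_apply, torusSin_apply, sub_eq_add_neg, fourier_apply_add, fourier_neg_apply,
    Complex.mul_re, Complex.conj_re, Complex.conj_im]
  ring

theorem torusCos_sub (l m : ℤ) (x : Torus) :
    torusCos (l - m) x = torusCos l x * torusCos m x + torusSin l x * torusSin m x := by
  simp only [torusCos_apply, torusSin_apply, sub_eq_add_neg, fourier_add, fourier_neg,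
    Complex.mul_re, Complex.conj_re, Complex.conj_im]
  ring

theorem abs_torusCos_le (j : ℤ) (x : Torus) : |torusCos j x| ≤ 1 :=
  (Complex.abs_re_le_norm _).trans (norm_fourier_apply j x).le

theorem exists_coe_eq_norm_eq (x : Torus) : ∃ t : ℝ, (t : Torus) = x ∧ |t| = ‖x‖ := by
  have hp := Real.two_pi_pos
  obtain ⟨t, ht, rfl⟩ : ∃ t ∈ Ico (-Real.pi) (-Real.pi + 2 * Real.pi), (t : Torus) = x :=
    ⟨_, (AddCircle.equivIco (2 * Real.pi) (-Real.pi) x).2, AddCircle.coe_equivIco ..⟩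
  refine ⟨t, rfl, ((AddCircle.norm_coe_eq_abs_iff (p := 2 * Real.pi) hp.ne').2 ?_).symm⟩
  rw [abs_of_pos hp, abs_le]
  constructor <;> linarith [ht.1, ht.2]

theorem fourier_coe_eq_exp (j : ℤ) (t : ℝ) :
    fourier j (t : Torus) = Complex.exp (Complex.I * ((j * t : ℝ) : ℂ)) := by
  rw [fourier_coe_apply]
  congr 1
  have : (Real.pi : ℂ) ≠ 0 := Complex.ofReal_ne_zero.2 Real.pi_ne_zero
  push_cast
  field_simp

theorem norm_fourier_sub_one_le (j : ℤ) (x : Torus) : ‖fourier j x - 1‖ ≤ |(j : ℝ)| * ‖x‖ := by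
  obtain ⟨t, rfl, ht⟩ := exists_coe_eq_norm_eq x
  rw [fourier_coe_eq_exp, ← ht, ← abs_mul]
  exact Real.norm_exp_I_mul_ofReal_sub_one_le

theorem abs_torusCos_sub_le (j : ℤ) (x y : Torus) :
    |torusCos j x - torusCos j y| ≤ |(j : ℝ)| * dist x y := by
  have h : fourier j x - fourier j y = fourier j y * (fourier j (x - y) - 1) := by
    rw [mul_sub, ← fourier_apply_add, add_sub_cancel, mul_one]
  calc |torusCos j x - torusCos j y| = |(fourier j x - fourier j y).re| := by
        rw [Complex.sub_re]; rfl
    _ ≤ ‖fourier j x - fourier j y‖ := Complex.abs_re_le_norm _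
    _ = ‖fourier j (x - y) - 1‖ := by rw [h, norm_mul, norm_fourier_apply, one_mul]
    _ ≤ |(j : ℝ)| * dist x y := by rw [dist_eq_norm]; exact norm_fourier_sub_one_le j _

theorem memHolder_torusCos {β : ℝ≥0} (hβ : β ≤ 1) (j : ℤ) : MemHolder β (torusCos j) := by
  refine MemHolder.of_le (r := 1) (memHolder_of_abs_sub_le (C := |(j : ℝ)|) (abs_nonneg _) ?_) hβ
  simpa using abs_torusCos_sub_le j

/-- The Fourier coefficients of an even real function are its cosine coefficients. -/
theorem fourierCoeff_of_even {f : C(Torus, ℝ)} (hf : ∀ x, f (-x) = f x) (j : ℤ) :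
    fourierCoeff (fun y : Torus => (f y : ℂ)) j = ((torusMean (f * torusCos j) : ℝ) : ℂ) := by
  have h0 : torusMean (f * torusSin (-j)) = 0 := torusMean_eq_zero_of_odd fun x => by
    simp only [Pi.mul_apply, hf, torusSin_neg_apply, mul_neg]
  have hre : Integrable (fun y => ((f * torusCos (-j)) y : ℂ))
      (AddCircle.haarAddCircle : Measure Torus) :=
    (f * torusCos (-j)).integrable_haarAddCircle.ofReal
  have him : Integrable (fun y => ((f * torusSin (-j)) y : ℂ) * Complex.I)
      (AddCircle.haarAddCircle : Measure Torus) :=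
    (f * torusSin (-j)).integrable_haarAddCircle.ofReal.mul_const _
  calc fourierCoeff (fun y : Torus => (f y : ℂ)) j
      = ∫ y, (((f * torusCos (-j)) y : ℂ) + ((f * torusSin (-j)) y : ℂ) * Complex.I)
          ∂(AddCircle.haarAddCircle : Measure Torus) := by
        refine integral_congr_ae (Eventually.of_forall fun y => ?_)
        simp only [ContinuousMap.mul_apply, torusCos_apply, torusSin_apply, smul_eq_mul]
        conv_lhs => rw [← Complex.re_add_im (fourier (-j) y)]
        push_cast
        ring
    _ = ((torusMean (f * torusCos (-j)) : ℝ) : ℂ)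
          + ((torusMean (f * torusSin (-j)) : ℝ) : ℂ) * Complex.I := by
        rw [integral_add hre him, integral_mul_const]
        congr 1
        · exact integral_ofReal
        · congr 1
          exact integral_ofReal
    _ = ((torusMean (f * torusCos j) : ℝ) : ℂ) := by
        rw [h0, torusCos_neg]
        simp

/-- The cosine is half of the mode `j` plus half of the mode `-j`; both indicators count when `i = j
= 0`. -/
theorem torusMean_torusCos_mul_torusCos (i j : ℤ) :
    torusMean (torusCos j * torusCos i) =
      ((if i = j then 1 else 0) + if i = -j then 1 else 0) / 2 := by
  have h1 : (fun y : Torus => (torusCos j y : ℂ)) =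
      ((1 / 2 : ℂ) • (fun y : Torus => fourier j y)) +
        ((1 / 2 : ℂ) • fun y : Torus => fourier (-j) y) := by
    ext y
    simp only [Pi.add_apply, Pi.smul_apply, fourier_neg, smul_eq_mul, ← mul_add]
    rw [Complex.add_conj, torusCos_apply]
    push_cast
    ring
  have hint : ∀ n : ℤ, Integrable ((1 / 2 : ℂ) • fun y : Torus => fourier n y)
      (AddCircle.haarAddCircle : Measure Torus) := fun n =>
    ((fourier n).continuous.integrable_of_hasCompactSupport
      (HasCompactSupport.of_compactSpace _)).smul _
  have h2 := fourierCoeff_of_even (torusCos_neg_apply j) i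
  rw [h1, fourierCoeff.add (hint j) (hint (-j)), Pi.add_apply,
    fourierCoeff.const_smul, fourierCoeff.const_smul, fourierCoeff_fourier,
    fourierCoeff_fourier, Pi.single_apply, Pi.single_apply] at h2
  apply Complex.ofReal_injective
  rw [← h2]
  split_ifs <;> norm_num

theorem torusMean_torusCos (j : ℤ) : torusMean (torusCos j) = if j = 0 then 1 else 0 := by
  have h := torusMean_torusCos_mul_torusCos j 0
  rw [torusCos_zero] at h
  simpa using h

end TorusFourier

/-! ### Cosine coefficients on the Hölder space -/

namespace EvenHolder

variable {β : ℝ≥0}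

/-- An even Hölder function of zero mean, from its defining properties. -/
noncomputable def ofCont (f : C(Torus, ℝ)) (h1 : MemHolder β f) (h2 : torusMean f = 0)
    (h3 : ∀ x, f (-x) = f x) : EvenHolder β :=
  (⟨f, h1, h2, h3⟩ : evenHolderSubmodule β)

/-- The function `cos (j x)` as an element of the Hölder space; zero if `j = 0`. -/
noncomputable def cosMode (hβ : β ≤ 1) (j : ℤ) : EvenHolder β :=
  if hj : j = 0 then 0 else
    ofCont (torusCos j) (memHolder_torusCos hβ j) (by rw [torusMean_torusCos, if_neg hj])
      (torusCos_neg_apply j)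

theorem toCont_cosMode (hβ : β ≤ 1) {j : ℤ} (hj : j ≠ 0) :
    (cosMode hβ j).toCont = torusCos j := by
  rw [cosMode, dif_neg hj]
  rfl

theorem cosMode_zero (hβ : β ≤ 1) : cosMode hβ 0 = 0 := dif_pos rfl

/-- The cosine coefficient, equal to the Fourier coefficient. -/
noncomputable def cosCoeff (j : ℤ) : EvenHolder β →L[ℝ] ℝ :=
  LinearMap.mkContinuous
    { toFun := fun φ => torusMean (φ.toCont * torusCos j)
      map_add' := fun φ ψ => by
        have := torusMean_add (φ.toCont * torusCos j) (ψ.toCont * torusCos j)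
        rw [toCont_add, ContinuousMap.coe_add, add_mul]
        exact this
      map_smul' := fun a φ => by
        rw [RingHom.id_apply, smul_eq_mul, ← torusMean_smul]
        congr 1
        ext x
        simp only [toCont_smul, ContinuousMap.smul_apply, Pi.smul_apply,
          Pi.mul_apply, smul_eq_mul, mul_assoc] } 1 fun φ => by
    refine abs_torusMean_le fun x => ?_
    rw [Pi.mul_apply, abs_mul, one_mul]
    calc |φ x| * |torusCos j x| ≤ ‖φ‖ * 1 := by
          gcongr
          · exact φ.abs_apply_le x
          · exact abs_torusCos_le j x
      _ = ‖φ‖ := mul_one _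

theorem cosCoeff_apply (j : ℤ) (φ : EvenHolder β) :
    cosCoeff j φ = torusMean (φ.toCont * torusCos j) := rfl

theorem cosCoeff_neg (j : ℤ) : cosCoeff (β := β) (-j) = cosCoeff j := by
  ext φ
  rw [cosCoeff_apply, cosCoeff_apply, torusCos_neg]

theorem cosCoeff_zero (φ : EvenHolder β) : cosCoeff 0 φ = 0 := by
  rw [cosCoeff_apply, torusCos_zero, ContinuousMap.coe_one, mul_one, torusMean_eq_zero]

theorem fourierCoeff_eq (φ : EvenHolder β) (j : ℤ) :
    fourierCoeff (fun y : Torus => (φ y : ℂ)) j = (cosCoeff j φ : ℂ) :=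
  fourierCoeff_of_even φ.even j

theorem cosCoeff_cosMode (hβ : β ≤ 1) {i : ℤ} (hi : i ≠ 0) (j : ℤ) :
    cosCoeff i (cosMode hβ j) = ((if i = j then 1 else 0) + if i = -j then 1 else 0) / 2 := by
  by_cases hj : j = 0
  · subst hj
    simp [cosMode_zero, hi]
  · rw [cosCoeff_apply, toCont_cosMode hβ hj, torusMean_torusCos_mul_torusCos]

/-- The Fourier series of an even Hölder function with summable coefficients. -/
theorem hasSum_fourier (φ : EvenHolder β) (h : Summable fun j : ℤ => cosCoeff j φ) (x : Torus) :
    HasSum (fun j : ℤ => (cosCoeff j φ : ℂ) * fourier j x) (φ x : ℂ) := by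
  let F : C(Torus, ℂ) := ⟨fun y => (φ y : ℂ), Complex.continuous_ofReal.comp φ.toCont.continuous⟩
  have hF : ∀ j, fourierCoeff F j = (cosCoeff j φ : ℂ) := φ.fourierCoeff_eq
  have hs : Summable (fourierCoeff F) := by
    rw [funext hF]
    exact Complex.ofRealCLM.summable h
  have := has_pointwise_sum_fourier_series_of_summable hs x
  simp only [hF, smul_eq_mul] at this
  exact this

/-- Positive frequencies suffice by evenness and zero mean. The difference has only zero
coefficients, so its Fourier series is trivially summable and represents it. -/
theorem ext_cosCoeff {φ ψ : EvenHolder β} (h : ∀ j : ℕ, j ≠ 0 → cosCoeff j φ = cosCoeff j ψ) :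
    φ = ψ := by
  have h1 : ∀ j : ℤ, cosCoeff j (φ - ψ) = 0 := by
    intro j
    rcases eq_or_ne j 0 with rfl | hj
    · exact cosCoeff_zero _
    · have h2 := h j.natAbs (Int.natAbs_ne_zero.2 hj)
      have h3 : cosCoeff (β := β) (j.natAbs : ℤ) = cosCoeff j := by
        rcases Int.natAbs_eq j with h4 | h4
        · rw [← h4]
        · conv_rhs => rw [h4, cosCoeff_neg]
      rw [h3] at h2
      rw [map_sub, h2, sub_self]
  refine toCont_injective (ContinuousMap.ext fun x => ?_)
  have h2 := hasSum_fourier (φ - ψ) (by simp only [h1]; exact summable_zero) x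
  simp only [h1, Complex.ofReal_zero, zero_mul] at h2
  have h3 := h2.unique hasSum_zero
  rw [Complex.ofReal_eq_zero, toCont_sub, ContinuousMap.sub_apply, sub_eq_zero] at h3
  exact h3

end EvenHolder

/-! ### Convex null sequences -/

section ConvexSequence

/-- The second difference of a sequence. -/
def secondDiff (a : ℕ → ℝ) (n : ℕ) : ℝ := a n - 2 * a (n + 1) + a (n + 2)

theorem sum_range_mul_secondDiff (a : ℕ → ℝ) (N : ℕ) :
    ∑ n ∈ Finset.range N, ((n : ℝ) + 1) * secondDiff a n =
      a 0 - a N - N * (a N - a (N + 1)) := by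
  induction N with
  | zero => simp
  | succ N ih =>
    rw [Finset.sum_range_succ, ih, secondDiff]
    push_cast
    ring

/-- Convexity makes the differences `a n - a (n + 1)` decrease; they tend to 0, so they are
nonnegative. -/
theorem antitone_of_secondDiff_nonneg {a : ℕ → ℝ} (ha : ∀ n, 0 ≤ secondDiff a n)
    (ha0 : Tendsto a atTop (𝓝 0)) :
    Antitone (fun n => a n - a (n + 1)) ∧ Antitone a := by
  have hd : Antitone (fun n => a n - a (n + 1)) := antitone_nat_of_succ_le fun n => by
    have := ha n
    rw [secondDiff] at this
    rw [show n + 1 + 1 = n + 2 from rfl]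
    linarith
  have hd0 : Tendsto (fun n => a n - a (n + 1)) atTop (𝓝 0) := by
    simpa using ha0.sub (ha0.comp (tendsto_add_atTop_nat 1))
  refine ⟨hd, antitone_nat_of_succ_le fun n => ?_⟩
  have := hd.le_of_tendsto hd0 n
  linarith

/-- Summation by parts leaves the boundary term `N (a N - a (N + 1))`. It has a limit because the
series has nonnegative terms and bounded partial sums, and the limit is 0 by comparison along even
indices. -/
theorem hasSum_mul_secondDiff {a : ℕ → ℝ} (ha : ∀ n, 0 ≤ secondDiff a n)
    (ha0 : Tendsto a atTop (𝓝 0)) :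
    HasSum (fun n : ℕ => ((n : ℝ) + 1) * secondDiff a n) (a 0) := by
  obtain ⟨hd, hanti⟩ := antitone_of_secondDiff_nonneg ha ha0
  have hnn : ∀ n : ℕ, 0 ≤ ((n : ℝ) + 1) * secondDiff a n := fun n =>
    mul_nonneg (by positivity) (ha n)
  have hsum : Summable (fun n : ℕ => ((n : ℝ) + 1) * secondDiff a n) := by
    refine summable_of_sum_range_le (c := a 0) hnn fun N => ?_
    rw [sum_range_mul_secondDiff]
    have h1 := hanti.le_of_tendsto ha0 N
    have h2 : 0 ≤ (N : ℝ) * (a N - a (N + 1)) :=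
      mul_nonneg N.cast_nonneg (sub_nonneg.2 (hanti N.le_succ))
    linarith
  obtain ⟨S, hS⟩ := hsum
  have hlim : Tendsto (fun N : ℕ => (N : ℝ) * (a N - a (N + 1))) atTop (𝓝 (a 0 - S)) := by
    have h1 := (tendsto_const_nhds (x := a 0)).sub (ha0.add hS.tendsto_sum_nat)
    rw [zero_add] at h1
    refine h1.congr fun N => ?_
    rw [sum_range_mul_secondDiff]
    ring
  have htwo : Tendsto (fun N : ℕ => N * 2) atTop atTop :=
    tendsto_id.atTop_mul_const' two_pos
  -- Each of the `N` differences between `a N` and `a (2 N)` is at least the later difference at `2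
  -- N`.
  have hle : ∀ N : ℕ, ((N * 2 : ℕ) : ℝ) * (a (N * 2) - a (N * 2 + 1)) ≤ 2 * (a N - a (N * 2)) := by
    intro N
    have h1 : ∀ M : ℕ, (M : ℝ) * (a (N * 2) - a (N * 2 + 1)) ≤ a (N * 2 - M) - a (N * 2) ∨
        N * 2 < M := by
      intro M
      induction M with
      | zero => left; simp
      | succ M ih =>
        rcases lt_or_ge (N * 2) (M + 1) with h | h
        · exact Or.inr h
        · left
          have h2 := ih.resolve_right (by omega)
          have h3 : a (N * 2) - a (N * 2 + 1) ≤
              a (N * 2 - (M + 1)) - a (N * 2 - (M + 1) + 1) := hd (by omega)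
          rw [show N * 2 - (M + 1) + 1 = N * 2 - M by omega] at h3
          push_cast
          linarith
    have h4 := (h1 N).resolve_right (by omega)
    rw [show N * 2 - N = N by omega] at h4
    push_cast
    linarith
  have hL : a 0 - S ≤ 0 := by
    refine le_of_tendsto_of_tendsto' (hlim.comp htwo) (b := atTop) ?_ hle
    have := (ha0.sub (ha0.comp htwo)).const_mul 2
    simpa using this
  have hL' : 0 ≤ a 0 - S := ge_of_tendsto' hlim fun N =>
    mul_nonneg N.cast_nonneg (sub_nonneg.2 (hanti N.le_succ))
  have : a 0 = S := by linarith
  rwa [this]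

/-- The previous sum for the sequence shifted by `j`; truncated subtraction kills the terms with `n
< j`. The weight `n + 1 - j` is the symbol at frequency `j` of the Fejér operator of order `n + 1`.
-/
theorem hasSum_sub_mul_secondDiff {a : ℕ → ℝ} (ha : ∀ n, 0 ≤ secondDiff a n)
    (ha0 : Tendsto a atTop (𝓝 0)) (j : ℕ) :
    HasSum (fun n : ℕ => ((n + 1 - j : ℕ) : ℝ) * secondDiff a n) (a j) := by
  have h1 := hasSum_mul_secondDiff (a := fun n => a (n + j))
    (fun n => by
      have := ha (n + j)
      simp only [secondDiff] at this ⊢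
      rwa [add_right_comm n 1 j, add_right_comm n 2 j])
    ((tendsto_add_atTop_iff_nat j).2 ha0)
  rw [zero_add] at h1
  rw [← hasSum_nat_add_iff' j, Finset.sum_eq_zero, sub_zero]
  · refine h1.congr_fun fun n => ?_
    rw [show n + j + 1 - j = n + 1 by omega]
    simp only [secondDiff]
    rw [add_right_comm n 1 j, add_right_comm n 2 j]
    push_cast
    rfl
  · intro n hn
    rw [Finset.mem_range] at hn
    rw [show n + 1 - j = 0 by omega]
    simp

/-- The sequence `n ^ (-α)`, continued to `n = 0` as a convex sequence. -/
noncomputable def powerSymbol (α : ℝ) (n : ℕ) : ℝ := if n = 0 then 2 else (n : ℝ) ^ (-α)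

theorem powerSymbol_of_ne_zero (α : ℝ) {n : ℕ} (hn : n ≠ 0) :
    powerSymbol α n = (n : ℝ) ^ (-α) := if_neg hn

theorem tendsto_powerSymbol {α : ℝ} (hα : 0 < α) : Tendsto (powerSymbol α) atTop (𝓝 0) := by
  refine ((tendsto_rpow_neg_atTop hα).comp tendsto_natCast_atTop_atTop).congr' ?_
  filter_upwards [eventually_ne_atTop 0] with n hn
  rw [powerSymbol_of_ne_zero α hn]
  rfl

theorem secondDiff_powerSymbol_nonneg {α : ℝ} (hα : 0 < α) (n : ℕ) :
    0 ≤ secondDiff (powerSymbol α) n := by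
  rcases eq_or_ne n 0 with rfl | hn
  -- The value 2 assigned at `n = 0` cancels `2 * 1 ^ (-α)`, leaving `2 ^ (-α)`. On zero-mean
  -- functions this value is immaterial.
  · have : (0 : ℝ) ≤ (2 : ℝ) ^ (-α) := by positivity
    simp [secondDiff, powerSymbol, this]
  · rw [secondDiff, powerSymbol_of_ne_zero α hn, powerSymbol_of_ne_zero α (by omega),
      powerSymbol_of_ne_zero α (by omega)]
    have hn0 : (0 : ℝ) < n := by exact_mod_cast Nat.pos_of_ne_zero hn
    have hsq : ∀ x : ℝ, 0 < x → x ^ (-α) = (x ^ (-α / 2)) ^ 2 := fun x hx => by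
      rw [← Real.rpow_natCast, ← Real.rpow_mul hx.le]
      congr 1
      push_cast
      ring
    -- Log-convexity, from `n (n + 2) ≤ (n + 1) ^ 2`; the arithmetic-geometric mean inequality then
    -- gives convexity.
    have h1 : (((n + 1 : ℕ) : ℝ)) ^ (-α) ≤ (n : ℝ) ^ (-α / 2) * ((n + 2 : ℕ) : ℝ) ^ (-α / 2) := by
      rw [hsq _ (by positivity), ← Real.mul_rpow hn0.le (by positivity), sq,
        ← Real.mul_rpow (by positivity) (by positivity)]
      refine Real.rpow_le_rpow_of_nonpos (by positivity) ?_ (by linarith)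
      push_cast
      nlinarith
    have h2 := two_mul_le_add_sq ((n : ℝ) ^ (-α / 2)) (((n + 2 : ℕ) : ℝ) ^ (-α / 2))
    rw [← hsq _ hn0, ← hsq _ (by positivity)] at h2
    linarith

end ConvexSequence

/-! ### Finite-rank operators -/

section CompactOperator

theorem isCompactOperator_smulRight {E : Type*} [NormedAddCommGroup E] [NormedSpace ℝ E]
    (ℓ : E →L[ℝ] ℝ) (v : E) : IsCompactOperator (ℓ.smulRight v) := by
  exact (isCompactOperator_of_locallyCompactSpace_dom ℓ).clm_comp
    (ContinuousLinearMap.toSpanSingleton ℝ v)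

theorem isCompactOperator_sum {ι E : Type*} [NormedAddCommGroup E] [NormedSpace ℝ E]
    (s : Finset ι) {T : ι → E →L[ℝ] E} (h : ∀ i ∈ s, IsCompactOperator (T i)) :
    IsCompactOperator (∑ i ∈ s, T i : E →L[ℝ] E) :=
  (compactOperator (RingHom.id ℝ) E E).sum_mem h

end CompactOperator

/-! ### The Fejér kernel -/

section Fejer

theorem torusMean_sum {ι : Type*} (s : Finset ι) (f : ι → C(Torus, ℝ)) :
    torusMean (∑ i ∈ s, f i : C(Torus, ℝ)) = ∑ i ∈ s, torusMean (f i) := by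
  simp only [torusMean]
  rw [← integral_finsetSum s fun i _ => (f i).integrable_haarAddCircle]
  simp

/-- The Fejér kernel of order `n`, normalised to have mean `n`. -/
noncomputable def fejerKernel (n : ℕ) : C(Torus, ℝ) :=
  ∑ l ∈ Finset.range n, ∑ m ∈ Finset.range n, torusCos ((l : ℤ) - m)

/-- The kernel is the squared modulus of `∑ e^{ilx}` over `l < n`. -/
theorem fejerKernel_nonneg (n : ℕ) (x : Torus) : 0 ≤ fejerKernel n x := by
  have h : fejerKernel n x = (∑ l ∈ Finset.range n, torusCos l x) ^ 2
      + (∑ l ∈ Finset.range n, torusSin l x) ^ 2 := by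
    simp only [fejerKernel, ContinuousMap.sum_apply, torusCos_sub, Finset.sum_add_distrib, sq,
      Finset.sum_mul_sum]
  rw [h]
  positivity

theorem torusMean_fejerKernel (n : ℕ) : torusMean (fejerKernel n) = n := by
  rw [fejerKernel, torusMean_sum]
  simp only [torusMean_sum, torusMean_torusCos, sub_eq_zero, Nat.cast_inj]
  have h : ∀ l ∈ Finset.range n, (∑ m ∈ Finset.range n, if l = m then (1 : ℝ) else 0) = 1 :=
    fun l hl => by rw [Finset.sum_ite_eq, if_pos hl]
  rw [Finset.sum_congr rfl h]
  simp

theorem abs_torusMean_mul_fejerKernel_le {g : C(Torus, ℝ)} {C : ℝ} (h : ∀ x, |g x| ≤ C) (n : ℕ) :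
    |torusMean (g * fejerKernel n)| ≤ n * C := by
  have h1 : Integrable (fun x => C * fejerKernel n x)
      (AddCircle.haarAddCircle : Measure Torus) :=
    (fejerKernel n).integrable_haarAddCircle.const_mul C
  have h2 := norm_integral_le_of_norm_le h1 (f := g * fejerKernel n)
    (Eventually.of_forall fun x => by
      rw [ContinuousMap.mul_apply, norm_mul, Real.norm_eq_abs, Real.norm_of_nonneg (fejerKernel_nonneg n x)]
      gcongr
      · exact fejerKernel_nonneg n x
      · exact h x)
  rw [integral_const_mul] at h2
  change _ ≤ C * torusMean (fejerKernel n) at h2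
  rw [torusMean_fejerKernel, mul_comm C] at h2
  exact h2

theorem card_sub_eq (n j : ℕ) :
    ∑ l ∈ Finset.range n, ∑ m ∈ Finset.range n, (if (j : ℤ) = (l : ℤ) - m then (1 : ℝ) else 0) =
      (n - j : ℕ) := by
  rw [Finset.sum_comm]
  have h1 : ∀ m ∈ Finset.range n, ∑ l ∈ Finset.range n,
      (if (j : ℤ) = (l : ℤ) - m then (1 : ℝ) else 0) = if m < n - j then 1 else 0 := by
    intro m _
    have h2 : ∀ l : ℕ, ((j : ℤ) = (l : ℤ) - m) ↔ m + j = l := fun l => by omega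
    simp only [h2, Finset.sum_ite_eq, Finset.mem_range]
    refine if_congr ?_ rfl rfl
    omega
  rw [Finset.sum_congr rfl h1, Finset.sum_boole]
  congr 1
  rw [show Finset.filter (fun m => m < n - j) (Finset.range n) = Finset.range (n - j) by
    ext m; simp only [Finset.mem_filter, Finset.mem_range]; omega]
  exact Finset.card_range _

end Fejer

/-! ### Fejér operators and convex multipliers -/

namespace EvenHolder

variable {β : ℝ≥0}

/-- Evaluation at a point, as a continuous linear functional. -/
noncomputable def evalCLM (x : Torus) : EvenHolder β →L[ℝ] ℝ :=
  (EvenHolderAlgebra.evalCLM x).comp toAlgebra.toContinuousLinearMap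

theorem evalCLM_apply (x : Torus) (φ : EvenHolder β) : evalCLM x φ = φ x := rfl

/-- The reflected translate `y ↦ φ (x - y)`. -/
noncomputable def reflTranslate (φ : EvenHolder β) (x : Torus) : C(Torus, ℝ) :=
  φ.toCont.comp ⟨fun y => x - y, continuous_const.sub continuous_id⟩

/-- Projection onto a mode is convolution with its cosine: in the addition formula the sine term
integrates to zero against an even function. -/
theorem cosCoeff_mul_torusCos (φ : EvenHolder β) (j : ℤ) (x : Torus) :
    cosCoeff j φ * torusCos j x = torusMean (φ.reflTranslate x * torusCos j) := by
  have h0 : torusMean (φ.toCont * torusSin j) = 0 := torusMean_eq_zero_of_odd fun y => by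
    simp only [Pi.mul_apply, φ.even, torusSin_neg_apply, mul_neg]
  have h1 := integral_sub_left_eq_self (fun y => φ y * torusCos j (x - y))
    (AddCircle.haarAddCircle : Measure Torus) x
  have h2 : torusMean (φ.reflTranslate x * torusCos j) =
      torusMean fun y => φ y * torusCos j (x - y) := by
    rw [torusMean, torusMean, ← h1]
    simp only [sub_sub_cancel]
    rfl
  have h3 : (fun y => φ y * torusCos j (x - y)) =
      ⇑(torusCos j x • (φ.toCont * torusCos j) + torusSin j x • (φ.toCont * torusSin j)) := by
    ext y
    simp only [torusCos_sub_apply, ContinuousMap.add_apply, ContinuousMap.smul_apply,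
      ContinuousMap.mul_apply, smul_eq_mul]
    ring
  rw [h2, h3, ContinuousMap.coe_add, torusMean_add, ContinuousMap.coe_smul,
    ContinuousMap.coe_smul, torusMean_smul, torusMean_smul, ContinuousMap.coe_mul,
    ContinuousMap.coe_mul, h0, cosCoeff_apply]
  ring

/-- Convolution with the Fejér kernel, as an operator of finite rank. -/
noncomputable def fejerOperator (hβ : β ≤ 1) (n : ℕ) : EvenHolder β →L[ℝ] EvenHolder β :=
  ∑ l ∈ Finset.range n, ∑ m ∈ Finset.range n,
    (cosCoeff ((l : ℤ) - m)).smulRight (cosMode hβ ((l : ℤ) - m))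

theorem isCompactOperator_fejerOperator (hβ : β ≤ 1) (n : ℕ) :
    IsCompactOperator (fejerOperator hβ n) :=
  isCompactOperator_sum _ fun _ _ => isCompactOperator_sum _ fun _ _ =>
    isCompactOperator_smulRight _ _

theorem fejerOperator_apply (hβ : β ≤ 1) (n : ℕ) (φ : EvenHolder β) (x : Torus) :
    fejerOperator hβ n φ x = torusMean (φ.reflTranslate x * fejerKernel n) := by
  have h1 : ∀ j : ℤ, cosCoeff j φ * cosMode hβ j x =
      torusMean (φ.reflTranslate x * torusCos j : C(Torus, ℝ)) := by
    intro j
    rw [ContinuousMap.coe_mul, ← cosCoeff_mul_torusCos]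
    rcases eq_or_ne j 0 with rfl | hj
    · rw [cosCoeff_zero, zero_mul, zero_mul]
    · rw [toCont_cosMode hβ hj]
  have h2 : fejerOperator hβ n φ x = ∑ l ∈ Finset.range n, ∑ m ∈ Finset.range n,
      cosCoeff ((l : ℤ) - m) φ * cosMode hβ ((l : ℤ) - m) x := by
    rw [← evalCLM_apply]
    simp only [fejerOperator, sum_apply, map_sum,
      ContinuousLinearMap.smulRight_apply, map_smul, smul_eq_mul, evalCLM_apply]
  rw [h2, ← ContinuousMap.coe_mul, fejerKernel, Finset.mul_sum, torusMean_sum]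
  simp only [Finset.mul_sum, torusMean_sum, h1]

/-- Convolution with a nonnegative kernel of mean `n` multiplies the supremum norm and the
translation-invariant Hölder seminorm by at most `n`. -/
theorem norm_fejerOperator_le (hβ : β ≤ 1) (n : ℕ) : ‖fejerOperator hβ n‖ ≤ n := by
  refine ContinuousLinearMap.opNorm_le_bound _ n.cast_nonneg fun φ => ?_
  rw [norm_def φ, mul_add]
  refine norm_le (by positivity) (by positivity) (fun x => ?_) fun x y => ?_
  · rw [fejerOperator_apply]
    exact abs_torusMean_mul_fejerKernel_le (g := φ.reflTranslate x)
      (fun y => φ.toCont.norm_coe_le_norm (x - y)) n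
  · rw [fejerOperator_apply, fejerOperator_apply, ← ContinuousMap.coe_mul,
      ← ContinuousMap.coe_mul, ← torusMean_sub, ← ContinuousMap.coe_sub, ← sub_mul, mul_assoc]
    refine abs_torusMean_mul_fejerKernel_le (g := φ.reflTranslate x - φ.reflTranslate y)
      (fun t => ?_) n
    refine (φ.abs_sub_le (x - t) (y - t)).trans_eq ?_
    rw [dist_sub_right]

/-- There are `n - j` pairs with `l - m = j` and as many with `l - m = -j`; each contributes one
half, the `j`-th cosine coefficient of the cosine itself. -/
theorem cosCoeff_fejerOperator (hβ : β ≤ 1) (n : ℕ) {j : ℕ} (hj : j ≠ 0) (φ : EvenHolder β) :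
    cosCoeff j (fejerOperator hβ n φ) = (n - j : ℕ) * cosCoeff j φ := by
  have hj' : (j : ℤ) ≠ 0 := by exact_mod_cast hj
  have h1 : ∀ i : ℤ, cosCoeff i φ * cosCoeff j (cosMode hβ i) =
      ((if (j : ℤ) = i then 1 else 0) + if (j : ℤ) = -i then 1 else 0) * (cosCoeff j φ / 2) := by
    intro i
    rw [cosCoeff_cosMode hβ hj']
    by_cases h2 : (j : ℤ) = i
    · rw [h2]; ring
    · by_cases h3 : (j : ℤ) = -i
      · rw [if_neg h2, h3, cosCoeff_neg]; ring
      · rw [if_neg h2, if_neg h3]; ring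
  simp only [fejerOperator, sum_apply, map_sum,
    ContinuousLinearMap.smulRight_apply, map_smul, smul_eq_mul, h1, neg_sub]
  simp only [← Finset.sum_mul, Finset.sum_add_distrib]
  rw [card_sub_eq, Finset.sum_comm, card_sub_eq]
  ring

/-- **Convex Fourier multipliers**: a convex null sequence is the symbol of a compact operator
on the Hölder space. -/
theorem exists_isCompactOperator_multiplier (hβ : β ≤ 1) {a : ℕ → ℝ}
    (ha : ∀ n, 0 ≤ secondDiff a n) (ha0 : Tendsto a atTop (𝓝 0)) :
    ∃ K : EvenHolder β →L[ℝ] EvenHolder β, IsCompactOperator K ∧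
      ∀ j : ℕ, j ≠ 0 → ∀ φ, cosCoeff j (K φ) = a j * cosCoeff j φ := by
  have hsum : Summable fun n => secondDiff a n • fejerOperator hβ (n + 1) := by
    refine Summable.of_norm_bounded (hasSum_mul_secondDiff ha ha0).summable fun n => ?_
    rw [norm_smul, Real.norm_of_nonneg (ha n), mul_comm]
    gcongr
    · exact ha n
    · exact_mod_cast norm_fejerOperator_le hβ (n + 1)
  obtain ⟨K, hK⟩ := hsum
  refine ⟨K, isCompactOperator_of_tendsto hK.tendsto_sum_nat (Eventually.of_forall fun N => ?_),
    fun j hj φ => ?_⟩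
  · exact isCompactOperator_sum _ fun n _ => (compactOperator (RingHom.id ℝ) _ _).smul_mem _
      (isCompactOperator_fejerOperator hβ (n + 1))
  · have h1 := (cosCoeff (β := β) j).hasSum (hK.mapL (ContinuousLinearMap.apply ℝ _ φ))
    have h2 := (hasSum_sub_mul_secondDiff ha ha0 j).mul_right (cosCoeff j φ)
    refine h1.unique (h2.congr_fun fun n => ?_)
    simp only [ContinuousLinearMap.apply_apply, map_smul,
      cosCoeff_fejerOperator hβ _ hj, smul_eq_mul]
    ring

end EvenHolder

/-! ### Parseval's identity and dyadic increments -/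

section Parseval

theorem hasSum_sq_norm_fourierCoeff (F : C(Torus, ℂ)) :
    HasSum (fun j : ℤ => ‖fourierCoeff F j‖ ^ 2)
      (∫ t, ‖F t‖ ^ 2 ∂(AddCircle.haarAddCircle : Measure Torus)) := by
  have h := hasSum_sq_fourierCoeff
    (ContinuousMap.toLp (E := ℂ) 2 (AddCircle.haarAddCircle : Measure Torus) ℂ F)
  simp only [fourierCoeff_toLp] at h
  have h2 : ∫ t, ‖ContinuousMap.toLp (E := ℂ) 2 (AddCircle.haarAddCircle : Measure Torus) ℂ F t‖ ^ 2
      ∂(AddCircle.haarAddCircle : Measure Torus) =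
      ∫ t, ‖F t‖ ^ 2 ∂(AddCircle.haarAddCircle : Measure Torus) := by
    refine integral_congr_ae ?_
    filter_upwards [ContinuousMap.coeFn_toLp (𝕜 := ℂ) (p := 2)
      (AddCircle.haarAddCircle : Measure Torus) F] with t ht
    rw [ht]
  rwa [h2] at h

/-- The step is matched to the dyadic block of `j`: `|j|` times the step lies in `[π / 2, π]`, where
`2 sin (θ / 2) ≥ 1` by Jordan's inequality. -/
theorem one_le_norm_fourier_sub_one {j : ℤ} (hj : j ≠ 0) :
    1 ≤ ‖fourier j ((Real.pi / 2 ^ (Nat.log 2 j.natAbs + 1) : ℝ) : Torus) - 1‖ := by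
  set m := Nat.log 2 j.natAbs with hm
  have hj0 : j.natAbs ≠ 0 := Int.natAbs_ne_zero.2 hj
  have h1 : ((2 : ℝ) ^ m) ≤ |(j : ℝ)| := by
    rw [← Int.cast_abs, Int.abs_eq_natAbs]
    exact_mod_cast Nat.pow_log_le_self 2 hj0
  have h2 : |(j : ℝ)| ≤ 2 ^ (m + 1) := by
    rw [← Int.cast_abs, Int.abs_eq_natAbs]
    exact_mod_cast (Nat.lt_pow_succ_log_self one_lt_two j.natAbs).le
  have hpos : (0 : ℝ) < 2 ^ m := by positivity
  rw [fourier_coe_eq_exp, Complex.norm_exp_I_mul_ofReal_sub_one, norm_mul, Real.norm_ofNat,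
    Real.norm_eq_abs, Real.abs_sin_eq_sin_abs_of_abs_le_pi, abs_div, abs_mul, abs_div,
    abs_of_pos Real.pi_pos, abs_of_pos (by positivity : (0 : ℝ) < 2 ^ (m + 1)), abs_two]
  · have h3 : 1 / 2 * (Real.pi / 2) ≤ |(j : ℝ)| * (Real.pi / 2 ^ (m + 1)) / 2 := by
      rw [pow_succ]
      calc 1 / 2 * (Real.pi / 2) = 2 ^ m * (Real.pi / (2 ^ m * 2)) / 2 := by field_simp
        _ ≤ _ := by gcongr
    have h4 : |(j : ℝ)| * (Real.pi / 2 ^ (m + 1)) / 2 ≤ Real.pi / 2 := by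
      gcongr
      calc |(j : ℝ)| * (Real.pi / 2 ^ (m + 1)) ≤ 2 ^ (m + 1) * (Real.pi / 2 ^ (m + 1)) := by
            gcongr
        _ = Real.pi := by field_simp
    have h5 := Real.mul_le_sin (by positivity) h4
    have h6 : 1 / 2 ≤ 2 / Real.pi * (|(j : ℝ)| * (Real.pi / 2 ^ (m + 1)) / 2) := by
      calc (1 : ℝ) / 2 = 2 / Real.pi * (1 / 2 * (Real.pi / 2)) := by
            have := Real.pi_pos.ne'
            field_simp
        _ ≤ _ := by gcongr
    linarith
  · rw [abs_div, abs_mul, abs_div, abs_of_pos Real.pi_pos,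
      abs_of_pos (by positivity : (0 : ℝ) < 2 ^ (m + 1)), abs_two]
    calc |(j : ℝ)| * (Real.pi / 2 ^ (m + 1)) / 2
        ≤ 2 ^ (m + 1) * (Real.pi / 2 ^ (m + 1)) / 2 := by gcongr
      _ = Real.pi / 2 := by field_simp
      _ ≤ Real.pi := half_le_self Real.pi_pos.le

end Parseval

/-! ### Bernstein's theorem and invertibility of the linearisation -/

namespace EvenHolder

variable {β : ℝ≥0}

/-- The increment `t ↦ φ (t + h) - φ t`, as a complex function. -/
noncomputable def increment (φ : EvenHolder β) (h : Torus) : C(Torus, ℂ) :=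
  ⟨fun t => ((φ (t + h) - φ t : ℝ) : ℂ), Complex.continuous_ofReal.comp
    ((φ.toCont.continuous.comp (continuous_id.add continuous_const)).sub φ.toCont.continuous)⟩

theorem fourierCoeff_increment (φ : EvenHolder β) (h : Torus) (j : ℤ) :
    fourierCoeff (φ.increment h) j = (fourier j h - 1) * (cosCoeff j φ : ℂ) := by
  have hc : Continuous fun t : Torus => fourier (-j) t * (φ (t + h) : ℂ) :=
    (map_continuous _).mul (Complex.continuous_ofReal.comp
      (φ.toCont.continuous.comp (continuous_id.add continuous_const)))
  have hc' : Continuous fun t : Torus => fourier (-j) t * (φ t : ℂ) :=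
    (map_continuous _).mul (Complex.continuous_ofReal.comp φ.toCont.continuous)
  have h1 : ∫ t, fourier (-j) t * (φ (t + h) : ℂ) ∂(AddCircle.haarAddCircle : Measure Torus) =
      fourier j h * (cosCoeff j φ : ℂ) := by
    have h2 := integral_add_right_eq_self (μ := (AddCircle.haarAddCircle : Measure Torus))
      (fun t => fourier (-j) (t - h) * (φ t : ℂ)) h
    simp only [add_sub_cancel_right] at h2
    rw [h2, ← fourierCoeff_eq, fourierCoeff, ← integral_const_mul]
    refine integral_congr_ae (Eventually.of_forall fun t => ?_)
    simp only [sub_eq_add_neg, fourier_apply_add, fourier_neg_apply, fourier_neg, map_mul,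
      Complex.conj_conj, smul_eq_mul]
    ring
  have h3 : ∫ t, fourier (-j) t * (φ t : ℂ) ∂(AddCircle.haarAddCircle : Measure Torus) =
      (cosCoeff j φ : ℂ) := by
    rw [← fourierCoeff_eq]
    rfl
  rw [sub_mul, one_mul, ← h1, ← h3, ← integral_sub
    (hc.integrable_of_hasCompactSupport (HasCompactSupport.of_compactSpace _))
    (hc'.integrable_of_hasCompactSupport (HasCompactSupport.of_compactSpace _))]
  refine integral_congr_ae (Eventually.of_forall fun t => ?_)
  simp only [increment, ContinuousMap.coe_mk, smul_eq_mul]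
  push_cast
  ring

/-- Bessel's inequality for the increment, which is bounded pointwise by the Hölder seminorm. -/
theorem sum_sq_fourier_sub_one_le (φ : EvenHolder β) (h : Torus) (s : Finset ℤ) :
    ∑ j ∈ s, (‖fourier j h - 1‖ * |cosCoeff j φ|) ^ 2 ≤
      (nnHolderNorm β φ * ‖h‖ ^ (β : ℝ)) ^ 2 := by
  have h1 := sum_le_hasSum s (fun _ _ => by positivity) (hasSum_sq_norm_fourierCoeff (φ.increment h))
  simp only [fourierCoeff_increment, norm_mul, Complex.norm_real, Real.norm_eq_abs] at h1
  refine h1.trans ((le_abs_self _).trans ?_)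
  refine abs_torusMean_le (f := fun t => ‖φ.increment h t‖ ^ 2) fun t => ?_
  rw [abs_of_nonneg (by positivity)]
  refine pow_le_pow_left₀ (norm_nonneg _) ?_ 2
  have h2 := φ.abs_sub_le (t + h) t
  rw [dist_eq_norm, add_sub_cancel_left] at h2
  rw [increment, ContinuousMap.coe_mk, Complex.norm_real]
  exact h2

/-- **Bernstein's theorem**: the Fourier series of a Hölder function of exponent larger than
`1 / 2` converges absolutely. -/
theorem summable_cosCoeff (hβ : 1 / 2 < (β : ℝ)) (φ : EvenHolder β) :
    Summable fun j : ℤ => cosCoeff j φ := by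
  -- The weights `w j` grow like `|j| ^ σ`: `σ < 2 β` makes the dyadic sums geometric with ratio `r
  -- < 1`, and `σ > 1` makes `∑ 1 / w j` converge. Such a `σ` exists exactly when `β > 1 / 2`.
  obtain ⟨σ, hσ1, hσ2⟩ : ∃ σ : ℝ, 1 < σ ∧ σ < 2 * β := ⟨β + 1 / 2, by linarith, by linarith⟩
  set w : ℤ → ℝ := fun j => ((2 : ℝ) ^ σ) ^ (Nat.log 2 j.natAbs) with hw
  have hw0 : ∀ j, 0 < w j := fun j => by positivity
  set N : ℝ := (nnHolderNorm β φ : ℝ) with hN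
  set D : ℝ := (N * Real.pi ^ (β : ℝ)) ^ 2 with hD
  set r : ℝ := (2 : ℝ) ^ σ / ((2 : ℝ) ^ (β : ℝ)) ^ 2 with hr
  have hr0 : 0 ≤ r := by positivity
  have hr1 : r < 1 := by
    rw [hr, div_lt_one (by positivity), ← Real.rpow_natCast, ← Real.rpow_mul (by norm_num)]
    refine Real.rpow_lt_rpow_of_exponent_lt (by norm_num) ?_
    push_cast
    linarith
  -- weighted square summability, one dyadic scale at a time
  have hscale : ∀ (m : ℕ) (s : Finset ℤ), ((2 : ℝ) ^ σ) ^ m * ∑ j ∈ s,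
      (‖fourier j ((Real.pi / 2 ^ (m + 1) : ℝ) : Torus) - 1‖ * |cosCoeff j φ|) ^ 2 ≤ D * r ^ m := by
    intro m s
    have h1 : ‖((Real.pi / 2 ^ (m + 1) : ℝ) : Torus)‖ ≤ Real.pi / 2 ^ m := by
      have h2 : ‖((Real.pi / 2 ^ (m + 1) : ℝ) : Torus)‖ ≤ |Real.pi / 2 ^ (m + 1)| :=
        QuotientAddGroup.norm_mk_le_norm
      rw [abs_of_pos (by positivity)] at h2
      refine h2.trans ?_
      gcongr
      · norm_num
      · omega
    calc _ ≤ ((2 : ℝ) ^ σ) ^ m * (N * (Real.pi / 2 ^ m) ^ (β : ℝ)) ^ 2 := by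
          gcongr
          refine (sum_sq_fourier_sub_one_le φ _ s).trans ?_
          gcongr
      _ = D * r ^ m := by
          rw [Real.div_rpow Real.pi_pos.le (by positivity),
            ← Real.rpow_pow_comm (by norm_num), hD, hr, div_pow]
          field_simp
          ring
  have hsq : Summable fun j => w j * (cosCoeff j φ) ^ 2 := by
    refine summable_of_sum_le (c := D * (1 - r)⁻¹) (fun j => mul_nonneg (hw0 j).le (sq_nonneg _))
      fun s => ?_
    set M := s.sup (fun j => Nat.log 2 j.natAbs) + 1 with hM
    calc ∑ j ∈ s, w j * (cosCoeff j φ) ^ 2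
        ≤ ∑ j ∈ s, ∑ m ∈ Finset.range M, ((2 : ℝ) ^ σ) ^ m *
          (‖fourier j ((Real.pi / 2 ^ (m + 1) : ℝ) : Torus) - 1‖ * |cosCoeff j φ|) ^ 2 := by
          refine Finset.sum_le_sum fun j hj => ?_
          rcases eq_or_ne j 0 with rfl | hj0
          · rw [cosCoeff_zero]
            simp
          · have hmem : Nat.log 2 j.natAbs ∈ Finset.range M := Finset.mem_range.2
              (Nat.lt_succ_of_le (Finset.le_sup (f := fun j : ℤ => Nat.log 2 j.natAbs) hj))
            refine le_trans ?_ (Finset.single_le_sum (fun m _ => by positivity) hmem)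
            rw [← sq_abs (cosCoeff j φ)]
            have h1 := one_le_norm_fourier_sub_one hj0
            have h2 : |cosCoeff j φ| ≤
                ‖fourier j ((Real.pi / 2 ^ (Nat.log 2 j.natAbs + 1) : ℝ) : Torus) - 1‖
                  * |cosCoeff j φ| := le_mul_of_one_le_left (abs_nonneg _) h1
            exact mul_le_mul_of_nonneg_left (pow_le_pow_left₀ (abs_nonneg _) h2 2) (hw0 j).le
      _ ≤ ∑ m ∈ Finset.range M, D * r ^ m := by
          rw [Finset.sum_comm]
          refine Finset.sum_le_sum fun m _ => ?_
          rw [← Finset.mul_sum]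
          exact hscale m s
      _ ≤ D * (1 - r)⁻¹ := by
          rw [← Finset.mul_sum, ← tsum_geometric_of_lt_one hr0 hr1]
          gcongr
          exact (summable_geometric_of_lt_one hr0 hr1).sum_le_tsum _ fun _ _ => by positivity
  have hinv : Summable fun j => (w j)⁻¹ := by
    refine Summable.of_norm_bounded_eventually
      ((Real.summable_abs_int_rpow hσ1).mul_left ((2 : ℝ) ^ σ)) ?_
    filter_upwards [(Set.finite_singleton (0 : ℤ)).compl_mem_cofinite] with j hj
    have hj0 : j ≠ 0 := hj
    have hjpos : (0 : ℝ) < |(j : ℝ)| := abs_pos.2 (by exact_mod_cast hj0)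
    rw [Real.norm_of_nonneg (inv_nonneg.2 (hw0 j).le), Real.rpow_neg hjpos.le, ← div_eq_mul_inv,
      inv_eq_one_div, div_le_div_iff₀ (hw0 j) (by positivity), one_mul]
    have h1 : |(j : ℝ)| ≤ 2 * 2 ^ (Nat.log 2 j.natAbs) := by
      rw [← Int.cast_abs, Int.abs_eq_natAbs, ← pow_succ']
      exact_mod_cast (Nat.lt_pow_succ_log_self one_lt_two j.natAbs).le
    calc |(j : ℝ)| ^ σ ≤ (2 * 2 ^ (Nat.log 2 j.natAbs)) ^ σ := by gcongr
      _ = 2 ^ σ * w j := by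
        rw [Real.mul_rpow (by norm_num) (by positivity), hw,
          ← Real.rpow_pow_comm (by norm_num)]
  -- The bound `|c| ≤ w c ^ 2 + 1 / w`, from expanding `w⁻¹ (w |c| - 1) ^ 2 ≥ 0`.
  refine Summable.of_norm_bounded ((hsq.add hinv)) fun j => ?_
  rw [Real.norm_eq_abs]
  have h1 : w j * (w j)⁻¹ = 1 := mul_inv_cancel₀ (hw0 j).ne'
  have h2 : (0 : ℝ) < (w j)⁻¹ := inv_pos.2 (hw0 j)
  rw [← sq_abs (cosCoeff j φ)]
  have h3 := sq_nonneg (w j * |cosCoeff j φ| - 1)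
  have h4 : 0 ≤ (w j)⁻¹ * (w j * |cosCoeff j φ| - 1) ^ 2 := by positivity
  have h5 : (w j)⁻¹ * (w j * |cosCoeff j φ| - 1) ^ 2 =
      (w j * (w j)⁻¹) * (w j * |cosCoeff j φ| ^ 2) - 2 * (w j * (w j)⁻¹) * |cosCoeff j φ|
        + (w j)⁻¹ := by ring
  rw [h5, h1] at h4
  have := abs_nonneg (cosCoeff j φ)
  linarith

theorem cosCoeff_natAbs (j : ℤ) : cosCoeff (β := β) (j.natAbs : ℤ) = cosCoeff j := by
  rcases Int.natAbs_eq j with h | h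
  · rw [← h]
  · conv_rhs => rw [h, cosCoeff_neg]

/-- The Fourier multiplier with symbol `|j| ^ (-α)` is the dispersion operator. -/
theorem dispersion_eq (hβ : 1 / 2 < (β : ℝ)) {α : ℝ} {K : EvenHolder β →L[ℝ] EvenHolder β}
    (hK : ∀ j : ℕ, j ≠ 0 → ∀ φ, cosCoeff j (K φ) = (j : ℝ) ^ (-α) * cosCoeff j φ)
    (φ : EvenHolder β) (x : Torus) : dispersion α φ x = (K φ x : ℂ) := by
  rw [← (hasSum_fourier (K φ) (summable_cosCoeff hβ (K φ)) x).tsum_eq, dispersion]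
  refine tsum_congr fun j => ?_
  split_ifs with hj
  · rw [hj, cosCoeff_zero]
    simp
  · have h1 := hK j.natAbs (Int.natAbs_ne_zero.2 hj) φ
    rw [cosCoeff_natAbs, Nat.cast_natAbs, Int.cast_abs] at h1
    rw [h1, fourierCoeff_eq]
    push_cast
    rfl

theorem cosCoeff_cosMode_nat (hβ : β ≤ 1) {j k : ℕ} (hj : j ≠ 0) :
    cosCoeff j (cosMode hβ k) = if j = k then 1 / 2 else 0 := by
  rw [cosCoeff_cosMode hβ (by exact_mod_cast hj)]
  have h1 : ¬ (j : ℤ) = -(k : ℤ) := by omega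
  rw [if_neg h1]
  by_cases h : j = k
  · rw [if_pos (by exact_mod_cast h), if_pos h]; norm_num
  · rw [if_neg (by exact_mod_cast h), if_neg h]; norm_num

/-- The linearised operator, modified along the kernel, is invertible. -/
theorem isInvertible_sub_smulRight (hβ : β ≤ 1) {K : EvenHolder β →L[ℝ] EvenHolder β}
    (hKc : IsCompactOperator K) {a : ℕ → ℝ}
    (hK : ∀ j : ℕ, j ≠ 0 → ∀ φ, cosCoeff j (K φ) = a j * cosCoeff j φ) {k : ℕ} (hk : k ≠ 0)
    (hak : a k ≠ 0) (hinj : ∀ j : ℕ, j ≠ 0 → a j = a k → j = k) :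
    (K - a k • ContinuousLinearMap.id ℝ (EvenHolder β)
      - ((2 : ℝ) • cosCoeff (k : ℤ)).smulRight (cosMode hβ k)).IsInvertible := by
  -- The rank-one term lowers the `k`-th symbol by 1 and leaves all others, so `a k` is no longer an
  -- eigenvalue of `T`.
  set T : EvenHolder β →L[ℝ] EvenHolder β :=
    K - ((2 : ℝ) • cosCoeff (k : ℤ)).smulRight (cosMode hβ k) with hT
  have hTc : IsCompactOperator T := hKc.sub (isCompactOperator_smulRight _ _)
  have hTcoeff : ∀ j : ℕ, j ≠ 0 → ∀ φ, cosCoeff j (T φ) =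
      (a j - if j = k then 1 else 0) * cosCoeff j φ := by
    intro j hj φ
    rw [hT, sub_apply, map_sub, hK j hj, ContinuousLinearMap.smulRight_apply, map_smul,
      cosCoeff_cosMode_nat hβ hj]
    split_ifs with h
    · subst h
      simp only [smul_apply, smul_eq_mul]
      ring
    · simp
  have hnot : ¬ Module.End.HasEigenvalue (T : Module.End ℝ (EvenHolder β)) (a k) := by
    intro h
    obtain ⟨φ, hφ⟩ := h.exists_hasEigenvector
    refine hφ.2 (ext_cosCoeff fun j hj => ?_)
    have h1 : T φ = a k • φ := hφ.apply_eq_smul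
    have h2 := hTcoeff j hj φ
    rw [h1, map_smul, smul_eq_mul] at h2
    rw [map_zero]
    by_cases hjk : j = k
    · rw [if_pos hjk, hjk] at h2
      rw [hjk]
      linarith
    · rw [if_neg hjk, sub_zero] at h2
      have h3 : (a j - a k) * cosCoeff j φ = 0 := by linarith
      exact (mul_eq_zero.1 h3).resolve_left fun h4 => hjk (hinj j hj (sub_eq_zero.1 h4))
  -- Fredholm alternative for the compact `T` at the nonzero value `a k`.
  have hres := (hTc.hasEigenvalue_or_mem_resolventSet hak).resolve_left hnot
  rw [spectrum.mem_resolventSet_iff, ← IsUnit.neg_iff] at hres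
  have heq : -(algebraMap ℝ (EvenHolder β →L[ℝ] EvenHolder β) (a k) - T) =
      K - a k • ContinuousLinearMap.id ℝ (EvenHolder β)
        - ((2 : ℝ) • cosCoeff (k : ℤ)).smulRight (cosMode hβ k) := by
    rw [Algebra.algebraMap_eq_smul_one, hT]
    change -(a k • ContinuousLinearMap.id ℝ (EvenHolder β) - _) = _
    abel
  rw [heq] at hres
  obtain ⟨u, hu⟩ := hres
  exact ⟨ContinuousLinearEquiv.unitsEquiv ℝ (EvenHolder β) u, by ext φ; rw [← hu]; rfl⟩

end EvenHolder

/-! ### Dilations of the torus and injectivity of the symbol -/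

section Preliminaries

theorem continuous_regNonlinearity (n : NonlinearityType) (p : ℝ) {ε : ℝ} (hε : 0 < ε) :
    Continuous (regNonlinearity n p ε) := by
  have h : ∀ q : ℝ, Continuous fun x : ℝ => (x ^ 2 + ε ^ 2) ^ q := fun q =>
    ((continuous_pow 2).add continuous_const).rpow_const fun x =>
      Or.inl (add_pos_of_nonneg_of_pos (sq_nonneg x) (pow_pos hε 2)).ne'
  cases n with
  | abs => exact (h _).sub continuous_const
  | sgn => exact continuous_id.mul ((h _).sub continuous_const)

theorem fourier_mul_apply (i j : ℤ) (x : Torus) : fourier (i * j) x = fourier j (i • x) := by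
  rw [fourier_apply, fourier_apply, mul_comm i j, mul_smul]

theorem torusMean_comp_nsmul {f : C(Torus, ℝ)} {k : ℕ} (hk : k ≠ 0) :
    torusMean (fun x => f (k • x)) = torusMean f := by
  have h : MeasurePreserving (fun x : Torus => (k : ℤ) • x) AddCircle.haarAddCircle
      AddCircle.haarAddCircle := Measure.measurePreserving_zsmul _ (by exact_mod_cast hk)
  simp only [natCast_zsmul] at h
  have h1 := integral_map (μ := (AddCircle.haarAddCircle : Measure Torus)) h.aemeasurable
    (f := f) (by rw [h.map_eq]; exact f.continuous.aestronglyMeasurable)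
  rw [h.map_eq] at h1
  exact h1.symm

theorem rpow_neg_injective {α : ℝ} (hα : 0 < α) {j k : ℕ}
    (h : (j : ℝ) ^ (-α) = (k : ℝ) ^ (-α)) : j = k := by
  exact_mod_cast (Real.rpow_left_inj j.cast_nonneg k.cast_nonneg (neg_ne_zero.2 hα.ne')).1 h

end Preliminaries

/-! ### Dilations, the concrete branch and its period -/

namespace EvenHolder

variable {β : ℝ≥0}

theorem abs_nsmul_sub_le (φ : EvenHolder β) (k : ℕ) (x y : Torus) :
    |φ (k • x) - φ (k • y)| ≤ (k : ℝ) ^ (β : ℝ) * nnHolderNorm β φ * dist x y ^ (β : ℝ) := by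
  refine (φ.abs_sub_le _ _).trans ?_
  have h1 : dist (k • x) (k • y) ≤ k * dist x y := by
    rw [dist_eq_norm, dist_eq_norm, ← nsmul_sub]
    exact norm_nsmul_le
  calc nnHolderNorm β φ * dist (k • x) (k • y) ^ (β : ℝ)
      ≤ nnHolderNorm β φ * (k * dist x y) ^ (β : ℝ) := by gcongr
    _ = (k : ℝ) ^ (β : ℝ) * nnHolderNorm β φ * dist x y ^ (β : ℝ) := by
      rw [Real.mul_rpow k.cast_nonneg dist_nonneg]
      ring

/-- The dilation `φ ↦ φ (k ·)`. -/
noncomputable def dilation {k : ℕ} (hk : k ≠ 0) : EvenHolder β →L[ℝ] EvenHolder β :=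
  LinearMap.mkContinuous
    { toFun := fun φ => ofCont (φ.toCont.comp ⟨fun x => k • x, continuous_nsmul k⟩)
        (memHolder_of_abs_sub_le (by positivity) (φ.abs_nsmul_sub_le k))
        ((torusMean_comp_nsmul (f := φ.toCont) hk).trans φ.torusMean_eq_zero)
        (fun x => (congrArg φ (smul_neg k x)).trans (φ.even (k • x)))
      map_add' := fun _ _ => rfl
      map_smul' := fun _ _ => rfl } (1 + (k : ℝ) ^ (β : ℝ)) fun φ => by
    refine (norm_le (C := ‖φ.toCont‖) (by positivity) (by positivity)
      (fun x => φ.toCont.norm_coe_le_norm (k • x)) (φ.abs_nsmul_sub_le k)).trans ?_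
    rw [norm_def]
    have h1 : 0 ≤ (k : ℝ) ^ (β : ℝ) * ‖φ.toCont‖ := by positivity
    have h2 : (0 : ℝ) ≤ nnHolderNorm β φ := NNReal.coe_nonneg _
    linarith

theorem dilation_apply {k : ℕ} (hk : k ≠ 0) (φ : EvenHolder β) (x : Torus) :
    dilation hk φ x = φ (k • x) := rfl

theorem dilation_add_period {k : ℕ} (hk : k ≠ 0) (φ : EvenHolder β) (x : Torus) :
    dilation hk φ (x + ((2 * Real.pi / k : ℝ) : Torus)) = dilation hk φ x := by
  rw [dilation_apply, dilation_apply, smul_add]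
  have h : k • ((2 * Real.pi / k : ℝ) : Torus) = 0 := by
    have hk' : (k : ℝ) ≠ 0 := by exact_mod_cast hk
    rw [← AddCircle.coe_nsmul, nsmul_eq_mul, mul_div_cancel₀ _ hk', AddCircle.coe_period]
  rw [h, add_zero]

theorem cosCoeff_dilation_mul {k : ℕ} (hk : k ≠ 0) (φ : EvenHolder β) (j : ℕ) :
    cosCoeff (k * j : ℕ) (dilation hk φ) = cosCoeff j φ := by
  rw [cosCoeff_apply, cosCoeff_apply, ← ContinuousMap.coe_mul φ.toCont, ← torusMean_comp_nsmul hk]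
  congr 1
  ext x
  have h : torusCos (k * j : ℕ) x = torusCos j (k • x) := by
    rw [torusCos_apply, torusCos_apply, Nat.cast_mul, fourier_mul_apply, natCast_zsmul]
  rw [Pi.mul_apply, h]
  rfl

/-- The increment over one period `2π / k` vanishes, so its coefficient `(e^{2πij/k} - 1) c_j` does;
the first factor is zero only if `k` divides `j`. -/
theorem cosCoeff_dilation_of_not_dvd {k : ℕ} (hk : k ≠ 0) (φ : EvenHolder β) {j : ℕ}
    (hj : ¬ k ∣ j) : cosCoeff j (dilation hk φ) = 0 := by
  set h : Torus := ((2 * Real.pi / k : ℝ) : Torus) with hh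
  have h1 := fourierCoeff_increment (dilation hk φ) h j
  have h2 : (dilation hk φ).increment h = 0 := by
    ext t
    rw [increment, ContinuousMap.coe_mk, dilation_add_period, sub_self]
    rfl
  have h3 : fourierCoeff (⇑(0 : C(Torus, ℂ))) (j : ℤ) = 0 := by simp [fourierCoeff]
  rw [h2, h3, eq_comm, mul_eq_zero, Complex.ofReal_eq_zero] at h1
  refine h1.resolve_left fun h4 => hj ?_
  rw [sub_eq_zero, hh, fourier_coe_eq_exp, Complex.exp_eq_one_iff] at h4
  obtain ⟨n, hn⟩ := h4
  have hk' : (k : ℂ) ≠ 0 := by exact_mod_cast hk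
  have hpi : (Real.pi : ℂ) ≠ 0 := Complex.ofReal_ne_zero.2 Real.pi_ne_zero
  have h5 : (j : ℂ) = n * k := by
    push_cast at hn
    field_simp at hn
    linear_combination hn
  have h6 : (j : ℤ) = k * n := by
    rw [mul_comm]
    exact_mod_cast h5
  exact Int.natCast_dvd_natCast.1 ⟨n, h6⟩

/-- Homogeneity of the symbol, `(k i) ^ (-α) = k ^ (-α) i ^ (-α)`. -/
theorem multiplier_dilation {α : ℝ} {K : EvenHolder β →L[ℝ] EvenHolder β}
    (hK : ∀ j : ℕ, j ≠ 0 → ∀ φ, cosCoeff j (K φ) = (j : ℝ) ^ (-α) * cosCoeff j φ)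
    {k : ℕ} (hk : k ≠ 0) (φ : EvenHolder β) :
    K (dilation hk φ) = (k : ℝ) ^ (-α) • dilation hk (K φ) := by
  refine ext_cosCoeff fun j hj => ?_
  rw [hK j hj, map_smul, smul_eq_mul]
  by_cases hdvd : k ∣ j
  · obtain ⟨i, rfl⟩ := hdvd
    have hi : i ≠ 0 := right_ne_zero_of_mul hj
    rw [cosCoeff_dilation_mul, cosCoeff_dilation_mul, hK i hi, Nat.cast_mul,
      Real.mul_rpow k.cast_nonneg i.cast_nonneg, mul_assoc]
  · rw [cosCoeff_dilation_of_not_dvd hk _ hdvd, cosCoeff_dilation_of_not_dvd hk _ hdvd, mul_zero,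
      mul_zero]

/-- The Fourier multiplier `|j| ^ (-α)` as a compact operator on the Hölder space. -/
theorem exists_isCompactOperator_dispersion (hβ : β ≤ 1) {α : ℝ} (hα : 0 < α) :
    ∃ K : EvenHolder β →L[ℝ] EvenHolder β, IsCompactOperator K ∧
      ∀ j : ℕ, j ≠ 0 → ∀ φ, cosCoeff j (K φ) = (j : ℝ) ^ (-α) * cosCoeff j φ := by
  obtain ⟨K, hK, hKa⟩ := exists_isCompactOperator_multiplier hβ
    (secondDiff_powerSymbol_nonneg hα) (tendsto_powerSymbol hα)
  exact ⟨K, hK, fun j hj φ => by rw [hKa j hj, powerSymbol_of_ne_zero α hj]⟩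

/-- The bifurcation curve of a Fourier multiplier at the eigenvalue of `cos (k x)`. -/
theorem exists_branch_of_multiplier (hβ : β ≤ 1) {K : EvenHolder β →L[ℝ] EvenHolder β}
    (hKc : IsCompactOperator K) {a : ℕ → ℝ}
    (hK : ∀ j : ℕ, j ≠ 0 → ∀ φ, cosCoeff j (K φ) = a j * cosCoeff j φ) {k : ℕ} (hk : k ≠ 0)
    (hak : a k ≠ 0) (hinj : ∀ j : ℕ, j ≠ 0 → a j = a k → j = k)
    {B : EvenHolder β → EvenHolder β →L[ℝ] EvenHolder β} (hB : AnalyticAt ℝ B 0)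
    (hB0 : B 0 = 0) :
    ∃ γ : ℝ → EvenHolder β × ℝ, AnalyticAt ℝ γ 0 ∧ γ 0 = (0, a k) ∧
      (∀ s, ((2 : ℝ) • cosCoeff (k : ℤ)) (γ s).1 = s) ∧
      (∀ᶠ s in 𝓝 0, K (γ s).1 - (γ s).2 • (γ s).1 + B (γ s).1 (γ s).1 = 0) ∧
      ∀ᶠ q in 𝓝 ((0 : EvenHolder β), a k), K q.1 - q.2 • q.1 + B q.1 q.1 = 0 → q.1 ≠ 0 →
        q = γ (((2 : ℝ) • cosCoeff (k : ℤ)) q.1) := by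
  refine exists_analytic_branch (v := cosMode hβ k) ?_ ?_ ?_
    (isInvertible_sub_smulRight hβ hKc hK hk hak hinj) hB hB0
  · rw [smul_apply, cosCoeff_cosMode_nat hβ hk, if_pos rfl]
    norm_num
  · refine ext_cosCoeff fun j hj => ?_
    rw [hK j hj, map_smul, smul_eq_mul, cosCoeff_cosMode_nat hβ hj]
    split_ifs with h
    · rw [h]
    · simp
  · intro φ
    rw [smul_apply, smul_apply, hK k hk, smul_eq_mul, smul_eq_mul]
    ring

/-- Near the bifurcation point, the steady equation is the abstract one. -/
theorem eventually_isSteadySolution_iff (hβ : 1 / 2 < (β : ℝ)) (n : NonlinearityType)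
    {α p ε : ℝ} {K : EvenHolder β →L[ℝ] EvenHolder β}
    (hK : ∀ j : ℕ, j ≠ 0 → ∀ φ, cosCoeff j (K φ) = (j : ℝ) ^ (-α) * cosCoeff j φ)
    {B : EvenHolder β → EvenHolder β →L[ℝ] EvenHolder β}
    (hB : ∀ᶠ φ in 𝓝 (0 : EvenHolder β), ∀ x, B φ φ x =
      regNonlinearity n p ε (φ x) - torusMean fun y => regNonlinearity n p ε (φ y))
    {c₀ : ℝ} (hc₀ : 0 < c₀) :
    ∀ᶠ q in 𝓝 ((0 : EvenHolder β), c₀),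
      (IsSteadySolution n α p ε q ↔ K q.1 - q.2 • q.1 + B q.1 q.1 = 0) := by
  have h1 : Tendsto (fun q : EvenHolder β × ℝ => q.1) (𝓝 (0, c₀)) (𝓝 0) :=
    continuous_fst.tendsto' _ _ rfl
  have h2 : Tendsto (fun q : EvenHolder β × ℝ => q.2) (𝓝 (0, c₀)) (𝓝 c₀) :=
    continuous_snd.tendsto' _ _ rfl
  filter_upwards [h1.eventually hB, h2.eventually (lt_mem_nhds hc₀)] with q hq1 hq2
  have h3 : ∀ x, steadyReg n α p ε q.1 q.2 x =
      (((K q.1 - q.2 • q.1 + B q.1 q.1) x : ℝ) : ℂ) := by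
    intro x
    have h4 : (K q.1 - q.2 • q.1 + B q.1 q.1) x = K q.1 x - q.2 * q.1 x + B q.1 q.1 x := rfl
    rw [h4, hq1, steadyReg, dispersion_eq hβ hK]
    push_cast
    ring
  simp only [IsSteadySolution, hq2.le, true_and, h3, Complex.ofReal_eq_zero]
  constructor
  · exact fun h => toCont_injective (ContinuousMap.ext h)
  · intro h x
    rw [h]
    rfl

/-- The bifurcating solutions inherit the period of the kernel: they are dilations of the
solutions that bifurcate at the first mode of a rescaled equation. -/
theorem eventually_periodic_branch (hβ : β ≤ 1) {n : NonlinearityType} {α p ε : ℝ} (hα : 0 < α)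
    (hε : 0 < ε)
    {K : EvenHolder β →L[ℝ] EvenHolder β} (hKc : IsCompactOperator K)
    (hK : ∀ j : ℕ, j ≠ 0 → ∀ φ, cosCoeff j (K φ) = (j : ℝ) ^ (-α) * cosCoeff j φ)
    {B : EvenHolder β → EvenHolder β →L[ℝ] EvenHolder β} (hBa : AnalyticAt ℝ B 0) (hB0 : B 0 = 0)
    (hB : ∀ᶠ φ in 𝓝 (0 : EvenHolder β), ∀ x, B φ φ x =
      regNonlinearity n p ε (φ x) - torusMean fun y => regNonlinearity n p ε (φ y))
    {k : ℕ} (hk : k ≠ 0) {γ : ℝ → EvenHolder β × ℝ}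
    (hγ : ∀ᶠ q in 𝓝 ((0 : EvenHolder β), (k : ℝ) ^ (-α)),
      K q.1 - q.2 • q.1 + B q.1 q.1 = 0 → q.1 ≠ 0 →
        q = γ (((2 : ℝ) • cosCoeff (k : ℤ)) q.1)) :
    ∀ᶠ s in 𝓝 (0 : ℝ), s ≠ 0 → ∃ φ : EvenHolder β, (γ s).1 = dilation hk φ := by
  have hk0 : (k : ℝ) ^ (-α) ≠ 0 :=
    (Real.rpow_pos_of_pos (by exact_mod_cast Nat.pos_of_ne_zero hk) _).ne'
  -- The factor `k ^ (-α)` is the one produced when `K` passes a dilation, so the rescaled problem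
  -- bifurcates at mode 1 from the same speed.
  obtain ⟨γ', hγ'a, hγ'0, hγ'ℓ, hγ's, -⟩ := exists_branch_of_multiplier hβ
    (K := (k : ℝ) ^ (-α) • K) (a := fun j => (k : ℝ) ^ (-α) * (j : ℝ) ^ (-α)) (k := 1)
    ((compactOperator (RingHom.id ℝ) _ _).smul_mem _ hKc)
    (fun j hj φ => by rw [smul_apply, map_smul, hK j hj, smul_eq_mul, mul_assoc]) one_ne_zero
    (by simpa using hk0)
    (fun j _ h => rpow_neg_injective hα (mul_left_cancel₀ hk0 h)) hBa hB0
  simp only [Nat.cast_one, Real.one_rpow, mul_one] at hγ'0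
  have hcont : Tendsto γ' (𝓝 0) (𝓝 (0, (k : ℝ) ^ (-α))) := by
    rw [← hγ'0]
    exact hγ'a.continuousAt
  have hfst : Tendsto (fun s => (γ' s).1) (𝓝 0) (𝓝 0) := (continuous_fst.tendsto _).comp hcont
  have hsnd : Tendsto (fun s => (γ' s).2) (𝓝 0) (𝓝 ((k : ℝ) ^ (-α))) :=
    (continuous_snd.tendsto _).comp hcont
  have hdil : Tendsto (fun s => dilation hk (γ' s).1) (𝓝 0) (𝓝 0) := by
    have := ((dilation (β := β) hk).continuous.tendsto 0).comp hfst
    rwa [map_zero] at this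
  filter_upwards [hγ's, hfst.eventually hB, hdil.eventually hB,
    (hdil.prodMk_nhds hsnd).eventually hγ] with s hs1 hs2 hs3 hs4 hs0
  have hBd : B (dilation hk (γ' s).1) (dilation hk (γ' s).1) =
      dilation hk (B (γ' s).1 (γ' s).1) := by
    refine toCont_injective (ContinuousMap.ext fun x => ?_)
    rw [hs3, dilation_apply, dilation_apply, hs2]
    exact congrArg _ (torusMean_comp_nsmul
      (f := ⟨_, (continuous_regNonlinearity n p hε).comp (γ' s).1.toCont.continuous⟩) hk)
  have hsol : K (dilation hk (γ' s).1) - (γ' s).2 • dilation hk (γ' s).1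
      + B (dilation hk (γ' s).1) (dilation hk (γ' s).1) = 0 := by
    rw [smul_apply] at hs1
    rw [hBd, multiplier_dilation hK, ← map_smul (dilation hk), ← map_smul (dilation hk), ← map_sub,
      ← map_add, hs1, map_zero]
  have hℓ : ((2 : ℝ) • cosCoeff (k : ℤ)) (dilation hk (γ' s).1) = s := by
    have h1 := cosCoeff_dilation_mul hk (γ' s).1 1
    rw [mul_one] at h1
    rw [smul_apply, h1]
    exact hγ'ℓ s
  have hne : dilation hk (γ' s).1 ≠ 0 := by
    intro h
    rw [h, map_zero] at hℓ
    exact hs0 hℓ.symm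
  -- The dilate is a nonzero solution near the bifurcation point with amplitude `s`, so uniqueness
  -- makes it `γ s`.
  have h5 := hs4 hsol hne
  rw [hℓ] at h5
  exact ⟨(γ' s).1, by rw [← h5]⟩

end EvenHolder

/-! ### The local bifurcation theorem -/

theorem mainTheorem8 (n : NonlinearityType) (α p : ℝ) (hα : 0 < α) (hα1 : α < 1) (hp : 1 < p)
    (β : ℝ≥0) (hαβ : α < β) (hβ : 1 / 2 < (β : ℝ)) (hβ1 : (β : ℝ) < 1)
    (ε : ℝ) (hε : 0 < ε) (k : ℕ) (hk : 1 ≤ k) :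
    ∃ δ > 0, ∃ γ : ℝ → EvenHolder β × ℝ,
      -- an analytic curve, injective and with nowhere vanishing velocity
      AnalyticOnNhd ℝ γ (Ioo (-δ) δ) ∧ InjOn γ (Ioo (-δ) δ) ∧
      (∀ s ∈ Ioo (-δ) δ, deriv γ s ≠ 0) ∧
      -- through the point `(0, k^(-α))`
      γ 0 = (0, (k : ℝ) ^ (-α)) ∧
      -- consisting of solutions, of period `2π / k`, nontrivial except at `s = 0`
      (∀ s ∈ Ioo (-δ) δ, IsSteadySolution n α p ε (γ s) ∧
        (∀ x : Torus, (γ s).1 (x + ((2 * Real.pi / k : ℝ) : Torus)) = (γ s).1 x) ∧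
        (s ≠ 0 → (γ s).1 ≠ 0)) ∧
      -- and near that point there are no other nontrivial solutions
      ∃ U ∈ 𝓝 ((0 : EvenHolder β), (k : ℝ) ^ (-α)),
        {q | q ∈ U ∧ IsSteadySolution n α p ε q ∧ q.1 ≠ 0} = γ '' (Ioo (-δ) δ \ {0}) := by
  have hk0 : k ≠ 0 := by omega
  have hβ1' : β ≤ 1 := by exact_mod_cast hβ1.le
  have hc₀ : 0 < (k : ℝ) ^ (-α) :=
    Real.rpow_pos_of_pos (by exact_mod_cast Nat.pos_of_ne_zero hk0) _
  obtain ⟨K, hKc, hK⟩ := EvenHolder.exists_isCompactOperator_dispersion hβ1' hα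
  obtain ⟨B, hBa, hB0, hB⟩ := EvenHolder.exists_analyticAt_regNonlinearity β n p hε
  obtain ⟨γ, hγa, hγ0, hγℓ, hγs, hγu⟩ := EvenHolder.exists_branch_of_multiplier hβ1' hKc
    (a := fun j => (j : ℝ) ^ (-α)) hK hk0 hc₀.ne'
    (fun j _ h => rpow_neg_injective hα h) hBa hB0
  set ℓ : EvenHolder β →L[ℝ] ℝ := (2 : ℝ) • EvenHolder.cosCoeff (k : ℤ) with hℓ
  have hper := EvenHolder.eventually_periodic_branch hβ1' hα hε hKc hK hBa hB0 hB hk0 hγu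
  have hiff := EvenHolder.eventually_isSteadySolution_iff hβ n hK hB hc₀
  have hcont : Tendsto γ (𝓝 0) (𝓝 (0, (k : ℝ) ^ (-α))) := by
    have := hγa.continuousAt.tendsto
    rwa [hγ0] at this
  obtain ⟨δ, hδ0, hδ⟩ := Metric.eventually_nhds_iff.1
    (hγa.eventually_analyticAt.and (hγs.and (hper.and (hcont.eventually (hiff.and hγu)))))
  have hδ' : ∀ s ∈ Ioo (-δ) δ, dist s 0 < δ := fun s hs => by
    rw [dist_zero_right, Real.norm_eq_abs]
    exact abs_lt.2 hs
  -- The normalisation `ℓ (γ s).1 = s` yields nontriviality here, and below injectivity and, by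
  -- differentiation, the nonvanishing velocity.
  have hne : ∀ s, s ≠ 0 → (γ s).1 ≠ 0 := fun s hs h => hs (by rw [← hγℓ s, h, map_zero])
  have hsol : ∀ s ∈ Ioo (-δ) δ, IsSteadySolution n α p ε (γ s) := fun s hs => by
    have h := hδ (hδ' s hs)
    exact h.2.2.2.1.2 h.2.1
  -- The neighbourhood collects the points where the reformulation and uniqueness hold; the
  -- constraint on `ℓ q.1` cuts its nontrivial solutions down to exactly the parameters `0 < |s| <
  -- δ`.
  refine ⟨δ, hδ0, γ, fun s hs => (hδ (hδ' s hs)).1, ?_, ?_, hγ0, fun s hs => ⟨hsol s hs, ?_,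
    hne s⟩, {q | ((IsSteadySolution n α p ε q ↔ K q.1 - q.2 • q.1 + B q.1 q.1 = 0) ∧
      (K q.1 - q.2 • q.1 + B q.1 q.1 = 0 → q.1 ≠ 0 → q = γ (ℓ q.1))) ∧ ℓ q.1 ∈ Ioo (-δ) δ}, ?_, ?_⟩
  · intro s _ t _ hst
    rw [← hγℓ s, ← hγℓ t, hst]
  · intro s hs h
    have h1 := (hδ (hδ' s hs)).1.differentiableAt.hasDerivAt
    rw [h] at h1
    have h2 : HasDerivAt (fun t => ℓ (γ t).1) (ℓ (0 : EvenHolder β × ℝ).1) s :=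
      (ℓ ∘L ContinuousLinearMap.fst ℝ (EvenHolder β) ℝ).hasFDerivAt.comp_hasDerivAt s h1
    simp only [hγℓ, Prod.fst_zero, map_zero] at h2
    exact one_ne_zero ((hasDerivAt_id' s).unique h2)
  · intro x
    rcases eq_or_ne s 0 with rfl | hs0
    · rw [hγ0]
      rfl
    · obtain ⟨φ, hφ⟩ := (hδ (hδ' s hs)).2.2.1 hs0
      rw [hφ]
      exact EvenHolder.dilation_add_period hk0 φ x
  · have h1 : Tendsto (fun q : EvenHolder β × ℝ => ℓ q.1) (𝓝 (0, (k : ℝ) ^ (-α))) (𝓝 0) :=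
      (ℓ.continuous.comp continuous_fst).tendsto' _ _ (map_zero ℓ)
    exact (hiff.and hγu).and (h1.eventually (Ioo_mem_nhds (neg_lt_zero.2 hδ0) hδ0))
  · ext q
    constructor
    · rintro ⟨⟨⟨hq1, hq2⟩, hq3⟩, hq4, hq5⟩
      have h1 := hq2 (hq1.1 hq4) hq5
      refine ⟨ℓ q.1, ⟨hq3, fun h2 => hq5 ?_⟩, h1.symm⟩
      rw [mem_singleton_iff] at h2
      rw [h1, h2, hγ0]
    · rintro ⟨s, ⟨hs, hs0⟩, rfl⟩
      refine ⟨⟨(hδ (hδ' s hs)).2.2.2, ?_⟩, hsol s hs, hne s hs0⟩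
      rw [hγℓ]
      exact hs
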